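/- Let $k=\mathbb{C}(q)$ and let $H=U_q(\mathfrak{sl}_2)$ be the $k$-algebra generated by $E,F,K^{\pm1}$ with $KEK^{-1}=q^2E$, $KFK^{-1}=q^{-2}F$, $EF-FE=\frac{K-K^{-1}}{q-q^{-1}}$, with the Hopf algebra structure $\Delta E=E\otimes K+1\otimes E$, $\Delta F=F\otimes 1+K^{-1}\otimes F$, $\Delta K=K\otimes K$, $\varepsilon(E)=\varepsilon(F)=0$, $\varepsilon(K)=1$, $SE=-EK^{-1}$, $SF=-KF$, $SK=K^{-1}$. Let $C=\mathbb{C}_q[\mathrm{SL}_2]$ be the bialgebra over $k$ generated by the entries of $X=\begin{pmatrix}a&b\\c&d\end{pmatrix}$ with $ba=qab$, $ca=qac$, $db=qbd$, $dc=qcd$, $cb=bc$, $ad-q^{-1}bc=da-qbc=1$, with $\Delta X_{ij}=\sum_k X_{ik}\otimes X_{kj}$, $\varepsilon(X_{ij})=\delta_{ij}$. Let $\varphi:C\otimes H\to k$ be the bialgebra pairing with $\varphi(X_{ij},h)=\rho(h)_{ij}$, where $\rho$ is the vector representation of $H$ on $V_1=k^2$: $\rho(E)=e_{12}$, $\rho(F)=e_{21}$,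 $\rho(K)=\mathrm{diag}(q,q^{-1})$. Let $D=D(H)$ be the quantum double: $D=C\otimes H$ as a vector space, $H$ is a subalgebra, $C$ is a subalgebra with its multiplication reversed, $c\otimes h=c\cdot h$, and $h\cdot c=\varphi(c_{(1)},Sh_{(1)})\,\varphi(c_{(3)},h_{(3)})\;c_{(2)}\cdot h_{(2)}$. The dual $D^*$ is a $D$-bimodule by $(x\blacktriangleright f)(y)=f(yx)$ and $(f\blacktriangleleft x)(y)=f(xy)$, and each element $\bar h\otimes\bar c$ of $H\otimes C$ is regarded as the element $c\otimes h\mapsto\varphi(c,\bar h)\,\varphi(\bar c,h)$ of $D^*$; we write $\bar h\bar c$ for it. Let $R=q^{\mathsf H\otimes \mathsf H/2}\bigl(1+(q-q^{-1})\rho(E)\otimes\rho(F)\bigr)$ with $\mathsf H=\mathrm{diag}(1,-1)$ be the $R$-matrix on $V_1\otimes V_1$. Let $V_1^+$ and $V_1^-$ be $V_1$ with $X_{kl}$ acting by the $(k,l)$ matrix entry in the second tensor factor of $R$, respectively in the first tensor factor of $R^{-1}$, and let $V_{1,1}=V_1^+\otimes V_1^-$, a $D$-module via $\Delta h=h_{(1)}\otimes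 h_{(2)}$ and $\Delta X_{kl}=\sum_m X_{km}\otimes X_{ml}$ (the scalars $q^{\pm1/2}$ in $R$ and $R^{-1}$ cancel, so $V_{1,1}$ is defined over $k$). Let $\mathcal{H}_{1,1}\subset D^*$ be the space of matrix coefficients of $V_{1,1}$, that is, the image of $V_{1,1}\otimes V_{1,1}^*\to D^*$, $v\otimes\zeta\mapsto(x\mapsto\zeta(xv))$. With $$\Delta=EF+\frac{q^{-1}K+qK^{-1}}{(q-q^{-1})^2}$$ let \begin{align*} \mathbf v_1&=(q-q^{-1})EK^{-1}ac-c^2,\\ \mathbf v_2&=(q-q^{-1})\Delta ac-\tfrac{q+q^{-1}}{q-q^{-1}}Kac-q^{-2}FKc^2+Ea^2,\\ \mathbf v_3&=EK^{-1},\\ \mathbf v_4&=\Delta . \end{align*} **Proposition.** $\mathcal{H}_{1,1}$ is a simple $D$-sub-bimodule of $D^*$ of dimension $16$. It is the span of the following sixteen elements $v_{ij}$ of $H\otimes C$ (which therefore form a basis of it): \begin{align*} &v_{11}=\mathbf v_3,\quad v_{12}=K^{-1},\quad v_{13}=F,\quad v_{14}=\mathbf v_4,\\ &v_{21}=\mathbf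 v_1,\quad v_{22}=(q-q^{-1})K^{-1}ac,\quad v_{23}=(q-q^{-1})Fac+a^2,\quad v_{24}=\mathbf v_2,\\ &v_{31}=(q^{-1}-q)EK^{-1}db+qd^2,\quad v_{32}=(q^{-1}-q)K^{-1}db,\quad v_{33}=(q^{-1}-q)Fdb-qb^2,\\ &v_{34}=(q^{-1}-q)\Delta db+\tfrac{q+q^{-1}}{q-q^{-1}}Kdb+q^{-1}FKd^2-qEb^2,\\ &v_{41}=(q-q^{-1})EK^{-1}bc-dc,\quad v_{42}=(q-q^{-1})K^{-1}bc,\quad v_{43}=(q-q^{-1})Fbc+qab,\\ &v_{44}=(q-q^{-1})\Delta bc-\tfrac{q+q^{-1}}{q-q^{-1}}Kbc-q^{-2}FKdc+qEab-\tfrac{1}{q-q^{-1}}K . \end{align*} The space of highest-weight bivectors $${}^+\mathcal{H}_{1,1}{}^+=\{v\in\mathcal{H}_{1,1}\mid E\blacktriangleright v=0=v\blacktriangleleft E\}$$ has dimension $4$ and is the linear span of $\mathbf v_1,\mathbf v_2,\mathbf v_3,\mathbf v_4$, which are homogeneous of weights $(2,2)$, $(2,0)$, $(0,2)$, $(0,0)$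 respectively, where $v$ has weight $(\omega_1,\omega_2)$ if $K\blacktriangleright v=q^{\omega_1}v$ and $v\blacktriangleleft K^{-1}=q^{\omega_2}v$. -/

import Mathlib

open scoped TensorProduct

noncomputable section

namespace QDouble

section Generic
variable {k C H : Type*} [Field k] [Ring C] [Ring H] [Bialgebra k C] [HopfAlgebra k H]

open Coalgebra

/-- iterated comultiplication `h ↦ h₍₁₎ ⊗ (h₍₂₎ ⊗ h₍₃₎)` -/
def comul₂ : H →ₗ[k] H ⊗[k] (H ⊗[k] H) := (comul (R := k) (A := H)).lTensor H ∘ₗ comul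

/-- `(a ⊗ b) ⊗ (c ⊗ d) ↦ a ⊗ ((b ⊗ c) ⊗ d)` -/
def reassoc₄ : (H ⊗[k] H) ⊗[k] (H ⊗[k] H) →ₗ[k] H ⊗[k] ((H ⊗[k] H) ⊗[k] H) :=
  (TensorProduct.assoc k H H H).symm.toLinearMap.lTensor H ∘ₗ
    (TensorProduct.assoc k H H (H ⊗[k] H)).toLinearMap

theorem reassoc₄_comul (h : H) : reassoc₄ (TensorProduct.map (comul (R := k)) comul (comul (R := k) h))
    = TensorProduct.map LinearMap.id (TensorProduct.map comul LinearMap.id) (comul₂ (k := k) h) := by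
  have : reassoc₄ ∘ₗ TensorProduct.map (comul (R := k)) comul ∘ₗ (comul (R := k) (A := H))
     = TensorProduct.map LinearMap.id (TensorProduct.map comul LinearMap.id) ∘ₗ comul₂ (k := k) := by
    simp only [reassoc₄, comul₂, coassoc_simps]
  exact LinearMap.congr_fun this h

/-- `(a ⊗ b) ⊗ (c ⊗ (d ⊗ e)) ↦ a ⊗ ((b ⊗ (c ⊗ d)) ⊗ e)` -/
def reassoc₅ : (H ⊗[k] H) ⊗[k] (H ⊗[k] (H ⊗[k] H)) →ₗ[k] H ⊗[k] ((H ⊗[k] (H ⊗[k] H)) ⊗[k] H) :=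
  ((TensorProduct.assoc k H H H).toLinearMap.rTensor H ∘ₗ
  (TensorProduct.assoc k (H ⊗[k] H) H H).symm.toLinearMap ∘ₗ (TensorProduct.assoc k H H (H ⊗[k] H)).symm.toLinearMap).lTensor H ∘ₗ
    (TensorProduct.assoc k H H (H ⊗[k] (H ⊗[k] H))).toLinearMap

theorem reassoc₅_comul (h : H) : reassoc₅ (TensorProduct.map (comul (R := k)) (TensorProduct.map LinearMap.id comul) (comul₂ (k := k) h))
    = TensorProduct.map LinearMap.id (TensorProduct.map comul₂ LinearMap.id) (comul₂ (k := k) h) := by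
  have : reassoc₅ ∘ₗ TensorProduct.map (comul (R := k)) (TensorProduct.map LinearMap.id comul) ∘ₗ (comul₂ (k := k) (H := H))
     = TensorProduct.map LinearMap.id (TensorProduct.map comul₂ LinearMap.id) ∘ₗ comul₂ (k := k) := by
    simp only [reassoc₅, comul₂, coassoc_simps]
  exact LinearMap.congr_fun this h

/-- `(a ⊗ ((b ⊗ c) ⊗ d)) ↦ S b c ⊗ S a d` -/
def antiAux : H ⊗[k] ((H ⊗[k] H) ⊗[k] H) →ₗ[k] H ⊗[k] H :=
  TensorProduct.lift (LinearMap.mk₂ k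
    (fun a (w : (H ⊗[k] H) ⊗[k] H) =>
      TensorProduct.map (LinearMap.mul' k H ∘ₗ (HopfAlgebra.antipode k).rTensor H)
        (LinearMap.mul k H (HopfAlgebra.antipode k a)) w)
    (fun a a' w => by simp [TensorProduct.map_add_right])
    (fun r a w => by simp [TensorProduct.map_smul_right])
    (fun a w w' => by simp) (fun r a w => by simp))

open HopfAlgebra WithConv in
theorem comul_antipode (h : H) :
    comul (R := k) (antipode k h) =
      TensorProduct.map (antipode k) (antipode k) (TensorProduct.comm k H H (comul (R := k) h)) := by
  let G : H →ₗ[k] H ⊗[k] H := TensorProduct.map (antipode k) (antipode k) ∘ₗ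
    (TensorProduct.comm k H H).toLinearMap ∘ₗ comul
  have h1 : toConv G * toConv (comul (R := k) (A := H)) = 1 := by
    apply WithConv.ext
    ext x
    have e1 : ∀ t : H ⊗[k] H, LinearMap.mul' k (H ⊗[k] H) (TensorProduct.map G comul t) =
        antiAux (reassoc₄ (TensorProduct.map (comul (R := k)) comul t)) := by
      intro t
      induction t using TensorProduct.induction_on with
      | zero => simp
      | add t u ht hu => simp only [map_add, ht, hu]
      | tmul a b =>
        simp only [TensorProduct.map_tmul, LinearMap.mul'_apply, G, LinearMap.comp_apply,
          LinearEquiv.coe_coe]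
        generalize comul (R := k) a = u
        generalize comul (R := k) b = v
        induction u using TensorProduct.induction_on with
        | zero => simp
        | add t u ht hu => simp only [map_add, add_mul, TensorProduct.add_tmul, ht, hu]
        | tmul a b =>
          induction v using TensorProduct.induction_on with
          | zero => simp
          | add t u ht hu => simp only [map_add, mul_add, TensorProduct.tmul_add, ht, hu]
          | tmul c d => simp [antiAux, reassoc₄]
    have e2 : ∀ t : H ⊗[k] (H ⊗[k] H), antiAux (TensorProduct.map LinearMap.id
        (TensorProduct.map (comul (R := k)) LinearMap.id) t) =
        (1 : H) ⊗ₜ[k] (LinearMap.mul' k H ((antipode k).rTensor H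
          ((LinearMap.lTensor H
            ((TensorProduct.lid k H).toLinearMap ∘ₗ counit.rTensor H)) t))) := by
      intro t
      induction t using TensorProduct.induction_on with
      | zero => simp
      | add t u ht hu => simp only [map_add, ht, hu, TensorProduct.tmul_add]
      | tmul a w =>
        induction w using TensorProduct.induction_on with
        | zero => simp
        | add t u ht hu => simp only [map_add, ht, hu, TensorProduct.tmul_add]
        | tmul b c =>
          simp [antiAux, Algebra.algebraMap_eq_smul_one, TensorProduct.smul_tmul]
    have e3 : (LinearMap.lTensor H ((TensorProduct.lid k H).toLinearMap ∘ₗ counit.rTensor H))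
        (comul₂ (k := k) x) = comul x := by
      rw [comul₂, LinearMap.comp_apply, ← LinearMap.comp_apply (LinearMap.lTensor _ _),
        ← LinearMap.lTensor_comp, LinearMap.comp_assoc, Coalgebra.rTensor_counit_comp_comul]
      have : (TensorProduct.lid k H).toLinearMap ∘ₗ (TensorProduct.mk k k H) 1 = LinearMap.id := by
        ext; simp
      rw [this]; simp
    simp only [LinearMap.convMul_def, LinearMap.convOne_def, LinearMap.comp_apply]
    rw [e1, reassoc₄_comul, e2]
    rw [e3, mul_antipode_rTensor_comul_apply]
    simp [Algebra.algebraMap_eq_smul_one, Algebra.TensorProduct.one_def]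
  have h2 := left_inv_eq_right_inv h1 LinearMap.comul_right_inv
  exact (LinearMap.congr_fun (congrArg WithConv.ofConv h2) h).symm

/-- A pairing of bialgebras `φ : C ⊗ H → k`:
`φ(c, h h') = φ(c₍₁₎, h) φ(c₍₂₎, h')`, `φ(c c', h) = φ(c, h₍₁₎) φ(c', h₍₂₎)`, `φ(1, h) = ε(h)` and
`φ(c, 1) = ε(c)`. -/
structure Pairing (k C H : Type*) [Field k] [Ring C] [Ring H] [Bialgebra k C] [Bialgebra k H] where
  φ : C →ₗ[k] H →ₗ[k] k
  map_mul_right : ∀ c h h', φ c (h * h') =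
    LinearMap.mul' k k (TensorProduct.map (φ.flip h) (φ.flip h') (comul (R := k) c))
  map_mul_left : ∀ c c' h, φ (c * c') h =
    LinearMap.mul' k k (TensorProduct.map (φ c) (φ c') (comul (R := k) h))
  map_one_left : ∀ h, φ 1 h = counit (R := k) h
  map_one_right : ∀ c, φ c 1 = counit (R := k) c

namespace Pairing
variable (P : Pairing k C H)

/-- `h ▷ c = c₍₁₎ φ(c₍₂₎, h)` -/
def lact : H →ₗ[k] C →ₗ[k] C :=
  LinearMap.mk₂ k (fun h c => TensorProduct.rid k C ((P.φ.flip h).lTensor C (comul (R := k) c)))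
    (fun h h' c => by simp [LinearMap.lTensor_add]) (fun r h c => by simp [LinearMap.lTensor_smul])
    (fun h c c' => by simp) (fun r h c => by simp)

/-- `c ◁ h = φ(c₍₁₎, h) c₍₂₎` -/
def ract : H →ₗ[k] C →ₗ[k] C :=
  LinearMap.mk₂ k (fun h c => TensorProduct.lid k C ((P.φ.flip h).rTensor C (comul (R := k) c)))
    (fun h h' c => by simp [LinearMap.rTensor_add]) (fun r h c => by simp [LinearMap.rTensor_smul])
    (fun h c c' => by simp) (fun r h c => by simp)

theorem lact_apply (h : H) (c : C) : P.lact h c =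
  TensorProduct.rid k C ((P.φ.flip h).lTensor C (comul (R := k) c)) := rfl
theorem ract_apply (h : H) (c : C) : P.ract h c =
  TensorProduct.lid k C ((P.φ.flip h).rTensor C (comul (R := k) c)) := rfl

theorem lact_mul (h h' : H) (c : C) : P.lact (h * h') c = P.lact h (P.lact h' c) := by
  let Ψ : C ⊗[k] (C ⊗[k] C) →ₗ[k] C := (TensorProduct.rid k C).toLinearMap ∘ₗ
    (LinearMap.mul' k k ∘ₗ TensorProduct.map (P.φ.flip h) (P.φ.flip h')).lTensor C
  have e1 : ∀ t : C ⊗[k] C, TensorProduct.rid k C ((P.φ.flip (h * h')).lTensor C t) =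
      Ψ (comul.lTensor C t) := by
    intro t
    induction t using TensorProduct.induction_on with
    | zero => simp
    | add t u ht hu => simp only [map_add, ht, hu]
    | tmul a b => simp [Ψ, P.map_mul_right]
  have e2 : ∀ t : C ⊗[k] C, P.lact h (TensorProduct.rid k C ((P.φ.flip h').lTensor C t)) =
      Ψ (TensorProduct.assoc k C C C (comul.rTensor C t)) := by
    intro t
    induction t using TensorProduct.induction_on with
    | zero => simp
    | add t u ht hu => simp only [map_add, ht, hu]
    | tmul a b =>
      simp only [LinearMap.lTensor_tmul, TensorProduct.rid_tmul, map_smul, lact_apply,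
        LinearMap.rTensor_tmul]
      generalize comul (R := k) a = u
      induction u using TensorProduct.induction_on with
      | zero => simp
      | add t u ht hu => simp only [map_add, ht, hu, TensorProduct.add_tmul, smul_add]
      | tmul c d => simp [Ψ, smul_smul, mul_comm]
  rw [lact_apply, lact_apply P h', e1, e2, Coalgebra.coassoc_apply]

theorem ract_mul (h h' : H) (c : C) : P.ract (h * h') c = P.ract h' (P.ract h c) := by
  let Ψ : C ⊗[k] (C ⊗[k] C) →ₗ[k] C := (TensorProduct.lid k C).toLinearMap ∘ₗ
    TensorProduct.map (P.φ.flip h) ((TensorProduct.lid k C).toLinearMap ∘ₗ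
      (P.φ.flip h').rTensor C)
  have e1 : ∀ t : C ⊗[k] C, TensorProduct.lid k C ((P.φ.flip (h * h')).rTensor C t) =
      Ψ (TensorProduct.assoc k C C C (comul.rTensor C t)) := by
    intro t
    induction t using TensorProduct.induction_on with
    | zero => simp
    | add t u ht hu => simp only [map_add, ht, hu]
    | tmul a b =>
      simp only [LinearMap.rTensor_tmul, TensorProduct.lid_tmul, LinearMap.flip_apply,
        P.map_mul_right]
      generalize comul (R := k) a = u
      induction u using TensorProduct.induction_on with
      | zero => simp
      | add t u ht hu => simp only [map_add, ht, hu, TensorProduct.add_tmul, add_smul]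
      | tmul c d => simp [Ψ, smul_smul, mul_comm]
  have e2 : ∀ t : C ⊗[k] C, P.ract h' (TensorProduct.lid k C ((P.φ.flip h).rTensor C t)) =
      Ψ (comul.lTensor C t) := by
    intro t
    induction t using TensorProduct.induction_on with
    | zero => simp
    | add t u ht hu => simp only [map_add, ht, hu]
    | tmul a b => simp [Ψ, ract_apply]
  rw [ract_apply, ract_apply P h, e1, e2, Coalgebra.coassoc_apply]

theorem lact_ract (h h' : H) (c : C) : P.lact h (P.ract h' c) = P.ract h' (P.lact h c) := by
  let Ψ : C ⊗[k] (C ⊗[k] C) →ₗ[k] C := (TensorProduct.lid k C).toLinearMap ∘ₗ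
    TensorProduct.map (P.φ.flip h') ((TensorProduct.rid k C).toLinearMap ∘ₗ
      (P.φ.flip h).lTensor C)
  have e1 : ∀ t : C ⊗[k] C, P.lact h (TensorProduct.lid k C ((P.φ.flip h').rTensor C t)) =
      Ψ (comul.lTensor C t) := by
    intro t
    induction t using TensorProduct.induction_on with
    | zero => simp
    | add t u ht hu => simp only [map_add, ht, hu]
    | tmul a b => simp [Ψ, lact_apply]
  have e2 : ∀ t : C ⊗[k] C, P.ract h' (TensorProduct.rid k C ((P.φ.flip h).lTensor C t)) =
      Ψ (TensorProduct.assoc k C C C (comul.rTensor C t)) := by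
    intro t
    induction t using TensorProduct.induction_on with
    | zero => simp
    | add t u ht hu => simp only [map_add, ht, hu]
    | tmul a b =>
      simp only [LinearMap.lTensor_tmul, TensorProduct.rid_tmul, map_smul, ract_apply,
        LinearMap.rTensor_tmul]
      generalize comul (R := k) a = u
      induction u using TensorProduct.induction_on with
      | zero => simp
      | add t u ht hu => simp only [map_add, ht, hu, TensorProduct.add_tmul, smul_add]
      | tmul c d => simp [Ψ, smul_smul]
  rw [ract_apply P h', lact_apply P h c, e1, e2, Coalgebra.coassoc_apply]

theorem lact_one (c : C) : P.lact 1 c = c := by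
  have : P.φ.flip 1 = counit (R := k) := by ext c; simp [P.map_one_right]
  simp [lact_apply, this]

theorem ract_one (c : C) : P.ract 1 c = c := by
  have : P.φ.flip 1 = counit (R := k) := by ext c; simp [P.map_one_right]
  simp [ract_apply, this]

/-- `(y ⊗ z) ↦ (y ▷ c)(z ▷ c')` -/
def lact₂ (c c' : C) : H ⊗[k] H →ₗ[k] C :=
  LinearMap.mul' k C ∘ₗ TensorProduct.map (P.lact.flip c) (P.lact.flip c')

/-- `(y ⊗ z) ↦ (c ◁ y)(c' ◁ z)` -/
def ract₂ (c c' : C) : H ⊗[k] H →ₗ[k] C :=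
  LinearMap.mul' k C ∘ₗ TensorProduct.map (P.ract.flip c) (P.ract.flip c')

theorem lact_mul_right (h : H) (c c' : C) :
    P.lact h (c * c') = P.lact₂ c c' (comul (R := k) h) := by
  let A : C ⊗[k] C →ₗ[k] H →ₗ[k] C := TensorProduct.lift
    (LinearMap.smulRightₗ ∘ₗ P.φ).flip
  have hA : ∀ u h, A u h = TensorProduct.rid k C ((P.φ.flip h).lTensor C u) := by
    intro u h
    induction u using TensorProduct.induction_on with
    | zero => simp
    | add t u ht hu => simp only [map_add, LinearMap.add_apply, ht, hu]
    | tmul a b => simp [A]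
  have hA' : ∀ c, P.lact.flip c = A (comul (R := k) c) := by
    intro c; ext h; rw [hA]; rfl
  have key : ∀ u v : C ⊗[k] C, A (u * v) h =
      LinearMap.mul' k C (TensorProduct.map (A u) (A v) (comul (R := k) h)) := by
    intro u v
    induction u using TensorProduct.induction_on with
    | zero => simp
    | add t u ht hu =>
      simp only [add_mul, map_add, LinearMap.add_apply, ht, hu, TensorProduct.map_add_left]
    | tmul a b =>
      induction v using TensorProduct.induction_on with
      | zero => simp
      | add t u ht hu =>
        simp only [mul_add, map_add, LinearMap.add_apply, ht, hu, TensorProduct.map_add_right]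
      | tmul a' b' =>
        simp only [Algebra.TensorProduct.tmul_mul_tmul, A, TensorProduct.lift.tmul,
          LinearMap.flip_apply, LinearMap.comp_apply, LinearMap.smulRightₗ_apply,
          LinearMap.smulRight_apply, P.map_mul_left]
        generalize comul (R := k) h = w
        induction w using TensorProduct.induction_on with
        | zero => simp
        | add t u ht hu => simp only [map_add, add_smul, ht, hu]
        | tmul x y => simp [smul_smul, mul_comm]
  rw [lact_apply, Bialgebra.comul_mul, ← hA, key, lact₂, hA', hA']
  rfl

theorem ract_mul_right (h : H) (c c' : C) :
    P.ract h (c * c') = P.ract₂ c c' (comul (R := k) h) := by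
  let A : C ⊗[k] C →ₗ[k] H →ₗ[k] C := TensorProduct.lift
    (LinearMap.smulRightₗ ∘ₗ P.φ)
  have hA : ∀ u h, A u h = TensorProduct.lid k C ((P.φ.flip h).rTensor C u) := by
    intro u h
    induction u using TensorProduct.induction_on with
    | zero => simp
    | add t u ht hu => simp only [map_add, LinearMap.add_apply, ht, hu]
    | tmul a b => simp [A]
  have hA' : ∀ c, P.ract.flip c = A (comul (R := k) c) := by
    intro c; ext h; rw [hA]; rfl
  have key : ∀ u v : C ⊗[k] C, A (u * v) h =
      LinearMap.mul' k C (TensorProduct.map (A u) (A v) (comul (R := k) h)) := by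
    intro u v
    induction u using TensorProduct.induction_on with
    | zero => simp
    | add t u ht hu =>
      simp only [add_mul, map_add, LinearMap.add_apply, ht, hu, TensorProduct.map_add_left]
    | tmul a b =>
      induction v using TensorProduct.induction_on with
      | zero => simp
      | add t u ht hu =>
        simp only [mul_add, map_add, LinearMap.add_apply, ht, hu, TensorProduct.map_add_right]
      | tmul a' b' =>
        simp only [Algebra.TensorProduct.tmul_mul_tmul, A, TensorProduct.lift.tmul,
          LinearMap.flip_apply, LinearMap.comp_apply, LinearMap.smulRightₗ_apply,
          LinearMap.smulRight_apply, P.map_mul_left]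
        generalize comul (R := k) h = w
        induction w using TensorProduct.induction_on with
        | zero => simp
        | add t u ht hu => simp only [map_add, add_smul, ht, hu]
        | tmul x y => simp [smul_smul, mul_comm]
  rw [ract_apply, Bialgebra.comul_mul, ← hA, key, ract₂, hA', hA']
  rfl

open HopfAlgebra in
theorem ract_antipode_mul_right (h : H) (c c' : C) :
    P.ract (antipode k h) (c * c') = P.ract₂ c c' (TensorProduct.map (antipode k) (antipode k)
      (TensorProduct.comm k H H (comul (R := k) h))) := by
  rw [ract_mul_right, comul_antipode]

/-- `x ⊗ z` acts on `C` by `c ↦ z ▷ c ◁ S x`. -/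
def sandwich : H ⊗[k] H →ₗ[k] Module.End k C :=
  TensorProduct.lift ((LinearMap.mul k (Module.End k C)).flip.compl₁₂
    (P.ract ∘ₗ HopfAlgebra.antipode k) P.lact)

@[simp] theorem sandwich_tmul (x z : H) (c : C) :
    P.sandwich (x ⊗ₜ z) c = P.lact z (P.ract (HopfAlgebra.antipode k x) c) := by
  simp [sandwich]

/-- `x ⊗ (y ⊗ z)` acts on `C ⊗ H` by `c ⊗ h ↦ (z ▷ c ◁ S x) ⊗ y h`. -/
def twist : H ⊗[k] (H ⊗[k] H) →ₗ[k] Module.End k (C ⊗[k] H) :=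
  TensorProduct.lift ((TensorProduct.mapBilinear (RingHom.id k) C H C H).flip.compl₁₂
    (LinearMap.mul k H) P.sandwich) ∘ₗ (TensorProduct.leftComm k H H H).toLinearMap

@[simp] theorem twist_tmul (x y z : H) (c : C) (h : H) :
    P.twist (x ⊗ₜ (y ⊗ₜ z)) (c ⊗ₜ h) =
      P.lact z (P.ract (HopfAlgebra.antipode k x) c) ⊗ₜ[k] (y * h) := by
  simp [twist]

/-- Left multiplication by `h ∈ H` in the quantum double:
`c ⊗ h' ↦ (h₍₃₎ ▷ c ◁ S h₍₁₎) ⊗ h₍₂₎ h'`. -/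
def mulH : H →ₗ[k] Module.End k (C ⊗[k] H) := P.twist ∘ₗ comul₂ (k := k)

/-- Left multiplication by `c ∈ C` in the quantum double: `c' ⊗ h ↦ c' c ⊗ h`
(the subalgebra of the double formed by `C` has the opposite multiplication). -/
def mulC : C →ₗ[k] Module.End k (C ⊗[k] H) :=
  (LinearMap.rTensorHom H) ∘ₗ (LinearMap.mul k C).flip

@[simp] theorem mulC_tmul (c c' : C) (h : H) :
    mulC (k := k) (H := H) c (c' ⊗ₜ h) = (c' * c) ⊗ₜ h := by
  simp [mulC]

/-- Multiplication of the quantum double: `(c ⊗ h) y = c · (h · y)`. -/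
def mulD : C ⊗[k] H →ₗ[k] Module.End k (C ⊗[k] H) :=
  TensorProduct.lift ((LinearMap.mul k (Module.End k (C ⊗[k] H))).compl₁₂ mulC P.mulH)

@[simp] theorem mulD_tmul (c : C) (h : H) (y : C ⊗[k] H) :
    P.mulD (c ⊗ₜ h) y = mulC c (P.mulH h y) := by
  simp [mulD]

theorem twist_mul (u v : H ⊗[k] (H ⊗[k] H)) : P.twist (u * v) = P.twist u * P.twist v := by
  induction u using TensorProduct.induction_on with
  | zero => simp
  | add t u ht hu => simp only [add_mul, map_add, ht, hu]
  | tmul x w =>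
    induction w using TensorProduct.induction_on with
    | zero => simp
    | add t u ht hu => simp only [TensorProduct.tmul_add, add_mul, map_add, ht, hu]
    | tmul y z =>
      induction v using TensorProduct.induction_on with
      | zero => simp
      | add t u ht hu => simp only [mul_add, map_add, ht, hu]
      | tmul x' w' =>
        induction w' using TensorProduct.induction_on with
        | zero => simp
        | add t u ht hu => simp only [TensorProduct.tmul_add, mul_add, map_add, ht, hu]
        | tmul y' z' =>
          ext c h
          simp [HopfAlgebra.antipode_mul_antidistrib, lact_mul, ract_mul, lact_ract, mul_assoc]

theorem comul₂_mul (h h' : H) :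
    comul₂ (k := k) (h * h') = comul₂ (k := k) h * comul₂ (k := k) h' := by
  have : ∀ u v : H ⊗[k] H, (comul (R := k) (A := H)).lTensor H (u * v) =
      comul.lTensor H u * comul.lTensor H v := by
    intro u v
    exact map_mul (Algebra.TensorProduct.map (AlgHom.id k H) (Bialgebra.comulAlgHom k H)) u v
  simp only [comul₂, LinearMap.comp_apply, Bialgebra.comul_mul, this]

theorem mulH_mul (h h' : H) : P.mulH (h * h') = P.mulH h * P.mulH h' := by
  simp only [mulH, LinearMap.comp_apply, comul₂_mul, twist_mul]

theorem mulH_one : P.mulH 1 = 1 := by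
  ext c h
  simp [mulH, comul₂, Algebra.TensorProduct.one_def, lact_one, ract_one]

theorem mulH_apply_one (h : H) : P.mulH h (1 ⊗ₜ 1) = 1 ⊗ₜ[k] h := by
  have hl : ∀ z, P.lact z 1 = counit (R := k) z • (1 : C) := by
    intro z
    simp [lact_apply, Algebra.TensorProduct.one_def, P.map_one_left]
  have hr : ∀ z, P.ract z 1 = counit (R := k) z • (1 : C) := by
    intro z
    simp [ract_apply, Algebra.TensorProduct.one_def, P.map_one_left]
  have e : ∀ t : H ⊗[k] H, P.twist (comul.lTensor H t) (1 ⊗ₜ 1) =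
      (1 : C) ⊗ₜ[k] (TensorProduct.lid k H (counit.rTensor H t)) := by
    intro t
    induction t using TensorProduct.induction_on with
    | zero => simp
    | add t u ht hu => simp only [map_add, LinearMap.add_apply, TensorProduct.tmul_add, ht, hu]
    | tmul x w =>
      have e' : ∀ t : H ⊗[k] H, P.twist (x ⊗ₜ t) (1 ⊗ₜ 1) = (counit (R := k) x • (1 : C)) ⊗ₜ[k]
          (TensorProduct.rid k H (counit.lTensor H t)) := by
        intro t
        induction t using TensorProduct.induction_on with
        | zero => simp
        | add t u ht hu =>
          simp only [map_add, LinearMap.add_apply, TensorProduct.tmul_add, ht, hu]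
        | tmul y z => simp [hl, hr, TensorProduct.smul_tmul, smul_smul, mul_comm]
      simp [e', TensorProduct.smul_tmul]
  rw [mulH, LinearMap.comp_apply, comul₂, LinearMap.comp_apply, e]
  simp

theorem mulC_mul (c c' : C) : mulC (k := k) (H := H) (c * c') = mulC c' * mulC c := by
  ext; simp [mul_assoc]

theorem mulC_one : mulC (k := k) (H := H) (1 : C) = 1 := by
  ext; simp

theorem mulD_mulC (c : C) (y : C ⊗[k] H) : P.mulD (mulC c y) = mulC c * P.mulD y := by
  induction y using TensorProduct.induction_on with
  | zero => simp
  | add t u ht hu => simp only [map_add, mul_add, ht, hu]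
  | tmul c' h =>
    apply LinearMap.ext; intro y
    simp [mulC_mul]

/-- right multiplication by `h` on the second factor -/
def rmulH (h : H) : C ⊗[k] H →ₗ[k] C ⊗[k] H := (LinearMap.mulRight k h).lTensor C

theorem mulD_rmulH (h : H) (y : C ⊗[k] H) : P.mulD (rmulH h y) = P.mulD y * P.mulH h := by
  induction y using TensorProduct.induction_on with
  | zero => simp
  | add t u ht hu => simp only [map_add, add_mul, ht, hu]
  | tmul c' h =>
    apply LinearMap.ext; intro y
    simp [rmulH, mulH_mul]

theorem mulH_rmulH (h h' : H) (y : C ⊗[k] H) : P.mulH h (rmulH h' y) = rmulH h' (P.mulH h y) := by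
  simp only [mulH, LinearMap.comp_apply]
  generalize comul₂ (k := k) h = u
  induction u using TensorProduct.induction_on with
  | zero => simp
  | add t u ht hu => simp only [map_add, LinearMap.add_apply, ht, hu]
  | tmul x w =>
    induction w using TensorProduct.induction_on with
    | zero => simp
    | add t u ht hu => simp only [TensorProduct.tmul_add, map_add, LinearMap.add_apply, ht, hu]
    | tmul y' z =>
      induction y using TensorProduct.induction_on with
      | zero => simp
      | add t u ht hu => simp only [map_add, ht, hu]
      | tmul c h => simp [rmulH, mul_assoc]

/-- `x₁ ⊗ ((x₂ ⊗ (y ⊗ z₁)) ⊗ z₂) ↦ (z₁ ▷ c' ◁ S x₂)(z₂ ▷ c ◁ S x₁) ⊗ y h'`, for `w = c' ⊗ h'` -/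
def hexAux (c : C) (w : C ⊗[k] H) :
    H ⊗[k] ((H ⊗[k] (H ⊗[k] H)) ⊗[k] H) →ₗ[k] C ⊗[k] H :=
  TensorProduct.lift ((mulC (k := k) (C := C) (H := H)).flip.compl₁₂ (P.twist.flip w)
    (P.sandwich.flip c)) ∘ₗ (TensorProduct.leftComm k H _ H).toLinearMap

theorem hexAux_tmul (c : C) (w : C ⊗[k] H) (a z : H) (u : H ⊗[k] (H ⊗[k] H)) :
    P.hexAux c w (a ⊗ₜ (u ⊗ₜ z)) =
      mulC (P.lact z (P.ract (HopfAlgebra.antipode k a) c)) (P.twist u w) := by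
  simp [hexAux]

theorem mulH_mulC (h : H) (c : C) :
    P.mulH h * mulC c = P.mulD (P.mulH h (c ⊗ₜ 1)) := by
  ext c'' h''
  have e1 : ∀ u : H ⊗[k] (H ⊗[k] H), P.twist u ((c'' * c) ⊗ₜ h'') =
      P.hexAux c (c'' ⊗ₜ h'') (reassoc₅ (TensorProduct.map (comul (R := k))
        (TensorProduct.map LinearMap.id comul) u)) := by
    intro u
    induction u using TensorProduct.induction_on with
    | zero => simp
    | add t u ht hu => simp only [map_add, LinearMap.add_apply, ht, hu]
    | tmul x w =>
      induction w using TensorProduct.induction_on with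
      | zero => simp
      | add t u ht hu => simp only [TensorProduct.tmul_add, map_add, LinearMap.add_apply, ht, hu]
      | tmul y z =>
        rw [twist_tmul, ract_antipode_mul_right]
        simp only [TensorProduct.map_tmul, LinearMap.id_apply]
        generalize comul (R := k) x = p
        induction p using TensorProduct.induction_on with
        | zero => simp
        | add t u ht hu => simp only [map_add, TensorProduct.add_tmul, ht, hu]
        | tmul x₁ x₂ =>
          simp only [TensorProduct.comm_tmul, TensorProduct.map_tmul, ract₂, LinearMap.comp_apply,
            LinearMap.mul'_apply, LinearMap.flip_apply, lact_mul_right]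
          generalize comul (R := k) z = r
          induction r using TensorProduct.induction_on with
          | zero => simp
          | add t u ht hu =>
            simp only [map_add, TensorProduct.add_tmul, TensorProduct.tmul_add, ht, hu]
          | tmul z₁ z₂ =>
            simp [reassoc₅, hexAux_tmul, lact₂]
  have e2 : ∀ u : H ⊗[k] (H ⊗[k] H), P.mulD (P.twist u (c ⊗ₜ 1)) (c'' ⊗ₜ h'') =
      P.hexAux c (c'' ⊗ₜ h'') (TensorProduct.map LinearMap.id
        (TensorProduct.map comul₂ LinearMap.id) u) := by
    intro u
    induction u using TensorProduct.induction_on with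
    | zero => simp
    | add t u ht hu => simp only [map_add, LinearMap.add_apply, ht, hu]
    | tmul x w =>
      induction w using TensorProduct.induction_on with
      | zero => simp
      | add t u ht hu => simp only [TensorProduct.tmul_add, map_add, LinearMap.add_apply, ht, hu]
      | tmul y z =>
        simp [hexAux_tmul, mulH]
  change P.mulH h (mulC c (c'' ⊗ₜ h'')) = P.mulD (P.mulH h (c ⊗ₜ 1)) (c'' ⊗ₜ h'')
  rw [mulC_tmul, mulH, LinearMap.comp_apply, e1, e2, reassoc₅_comul]

theorem mulD_mulD (x y : C ⊗[k] H) : P.mulD (P.mulD x y) = P.mulD x * P.mulD y := by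
  induction x using TensorProduct.induction_on with
  | zero => simp
  | add t u ht hu => simp only [map_add, LinearMap.add_apply, add_mul, ht, hu]
  | tmul c h =>
    have hx : P.mulD (c ⊗ₜ h) = mulC c * P.mulH h := by
      apply LinearMap.ext; intro z; simp
    have : ∀ y, P.mulD (P.mulH h y) = P.mulH h * P.mulD y := by
      intro y
      induction y using TensorProduct.induction_on with
      | zero => simp
      | add t u ht hu => simp only [map_add, mul_add, ht, hu]
      | tmul c' h' =>
        have e : (c' ⊗ₜ h' : C ⊗[k] H) = rmulH h' (c' ⊗ₜ 1) := by simp [rmulH]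
        have e' : P.mulD (c' ⊗ₜ h') = mulC c' * P.mulH h' := by
          apply LinearMap.ext; intro z; simp
        rw [e', e, mulH_rmulH, mulD_rmulH, ← mulH_mulC, mul_assoc]
    rw [mulD_tmul, mulD_mulC, this, hx, mul_assoc]

theorem mulD_one (x : C ⊗[k] H) : P.mulD x (1 ⊗ₜ 1) = x := by
  induction x using TensorProduct.induction_on with
  | zero => simp
  | add t u ht hu => simp only [map_add, LinearMap.add_apply, ht, hu]
  | tmul c h => simp [mulH_apply_one]

end Pairing

/-- The quantum double `D = C ⊗ H` determined by a pairing. Its multiplication is `Pairing.mulD`, so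
that `(c ⊗ h) = c · h`, the elements `h ∈ H` multiply as in `H`, the elements `c ∈ C` multiply in the
opposite order, and `h · c = (h₍₃₎ ▷ c ◁ S h₍₁₎) · h₍₂₎ = φ(c₍₁₎, S h₍₁₎) φ(c₍₃₎, h₍₃₎) c₍₂₎ · h₍₂₎`. -/
def Double (_P : Pairing k C H) : Type _ := C ⊗[k] H

namespace Double
variable (P : Pairing k C H)

instance : AddCommGroup (Double P) := inferInstanceAs (AddCommGroup (C ⊗[k] H))
instance : Module k (Double P) := inferInstanceAs (Module k (C ⊗[k] H))

/-- The identification of `C ⊗ H` with the underlying vector space of the quantum double. -/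
def ofTensor : C ⊗[k] H ≃ₗ[k] Double P := LinearEquiv.refl k _

instance : Mul (Double P) :=
  ⟨fun x y => ofTensor P (P.mulD ((ofTensor P).symm x) ((ofTensor P).symm y))⟩
instance : One (Double P) := ⟨ofTensor P (1 ⊗ₜ 1)⟩

theorem mul_def (x y : Double P) :
  x * y = ofTensor P (P.mulD ((ofTensor P).symm x) ((ofTensor P).symm y)) := rfl
theorem one_def : (1 : Double P) = ofTensor P (1 ⊗ₜ 1) := rfl

instance : Ring (Double P) :=
  { (inferInstance : AddCommGroup (Double P)), (inferInstance : Mul (Double P)),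
    (inferInstance : One (Double P)) with
    mul_assoc := fun x y z => by simp [mul_def, P.mulD_mulD]
    one_mul := fun x => by simp [mul_def, one_def, P.mulD_tmul, P.mulH_one, Pairing.mulC_one]
    mul_one := fun x => by
      rw [mul_def, one_def, LinearEquiv.symm_apply_apply, P.mulD_one, LinearEquiv.apply_symm_apply]
    left_distrib := fun x y z => by simp [mul_def]
    right_distrib := fun x y z => by simp [mul_def]
    zero_mul := fun x => by simp [mul_def]
    mul_zero := fun x => by simp [mul_def] }

instance : Algebra k (Double P) :=
  Algebra.ofModule (by intros; simp [mul_def]) (by intros; simp [mul_def])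

/-- The inclusion of `H` into the quantum double. -/
def ofH (h : H) : Double P := ofTensor P (1 ⊗ₜ h)

/-- The inclusion of `C` (with opposite multiplication) into the quantum double. -/
def ofC (c : C) : Double P := ofTensor P (c ⊗ₜ 1)

theorem ofH_mul (h h' : H) : ofH P h * ofH P h' = ofH P (h * h') := by
  rw [ofH, ofH, mul_def, LinearEquiv.symm_apply_apply, LinearEquiv.symm_apply_apply,
    P.mulD_tmul, Pairing.mulC_one, Module.End.one_apply, ← P.mulH_apply_one h',
    ← Module.End.mul_apply, ← P.mulH_mul, P.mulH_apply_one, ofH]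

theorem ofC_mul (c c' : C) : ofC P c * ofC P c' = ofC P (c' * c) := by
  simp [ofC, mul_def, P.mulH_one]

theorem ofC_mul_ofH (c : C) (h : H) : ofC P c * ofH P h = ofTensor P (c ⊗ₜ h) := by
  simp [ofC, ofH, mul_def, P.mulH_one]

theorem ofH_mul_ofC (h : H) (c : C) : ofH P h * ofC P c = ofTensor P (P.mulH h (c ⊗ₜ 1)) := by
  simp [ofC, ofH, mul_def, Pairing.mulC_one]

/-- The map `H ⊗ C → D^*`, `ι(h' ⊗ c')(c ⊗ h) = φ(c, h') φ(c', h)`. -/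
def ι : H ⊗[k] C →ₗ[k] Module.Dual k (Double P) :=
  TensorProduct.lift (LinearMap.mk₂ k
    (fun h' c' => LinearMap.mul' k k ∘ₗ TensorProduct.map (P.φ.flip h') (P.φ c') ∘ₗ
      (ofTensor P).symm.toLinearMap)
    (fun h h' c => by ext; simp [TensorProduct.map_add_left])
    (fun r h c => by ext; simp [TensorProduct.map_smul_left])
    (fun h c c' => by ext; simp [TensorProduct.map_add_right])
    (fun r h c => by ext; simp [TensorProduct.map_smul_right]))

theorem ι_tmul (h' h : H) (c' c : C) :
    ι P (h' ⊗ₜ c') (ofTensor P (c ⊗ₜ h)) = P.φ c h' * P.φ c' h := by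
  simp [ι]

end Double

end Generic

section DualBimodule
variable {k B V : Type*} [Field k] [Ring B] [Algebra k B] [AddCommGroup V] [Module k V]

/-- The left action of `B` on `B^*`: `(x ▸ f)(y) = f(y x)`. -/
def dualLeft (x : B) : Module.Dual k B →ₗ[k] Module.Dual k B := (LinearMap.mulRight k x).dualMap

/-- The right action of `B` on `B^*`: `(f ◂ x)(y) = f(x y)`. -/
def dualRight (x : B) : Module.Dual k B →ₗ[k] Module.Dual k B := (LinearMap.mulLeft k x).dualMap

theorem dualLeft_apply (x y : B) (f : Module.Dual k B) : dualLeft x f y = f (y * x) := rfl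

theorem dualRight_apply (x y : B) (f : Module.Dual k B) : dualRight x f y = f (x * y) := rfl

/-- A subspace of `B^*` stable under both actions of `B`. -/
def IsSubBimodule (W : Submodule k (Module.Dual k B)) : Prop :=
  ∀ x : B, ∀ f ∈ W, dualLeft x f ∈ W ∧ dualRight x f ∈ W

/-- A simple sub-bimodule of `B^*`. -/
def IsSimpleSubBimodule (W : Submodule k (Module.Dual k B)) : Prop :=
  IsSubBimodule W ∧ W ≠ ⊥ ∧ ∀ U ≤ W, IsSubBimodule U → U = ⊥ ∨ U = W

/-- The matrix coefficient map `β_V : V ⊗ V^* → B^*`, `β_V(v ⊗ ζ)(x) = ζ(x v)`, of a `B`-module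
`V`. -/
def matrixCoeff (π : B →ₐ[k] Module.End k V) :
    V ⊗[k] Module.Dual k V →ₗ[k] Module.Dual k B :=
  TensorProduct.lift (LinearMap.mk₂ k (fun v ζ => ζ ∘ₗ LinearMap.applyₗ v ∘ₗ π.toLinearMap)
    (fun v v' ζ => by ext; simp) (fun r v ζ => by ext; simp)
    (fun v ζ ζ' => by ext; simp) (fun r v ζ => by ext; simp))

theorem matrixCoeff_tmul (π : B →ₐ[k] Module.End k V) (v : V) (ζ : Module.Dual k V) (x : B) :
    matrixCoeff π (v ⊗ₜ ζ) x = ζ (π x v) := by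
  simp [matrixCoeff]

end DualBimodule

/-- The ground field `ℂ(q)`. -/
def Kq : Type := RatFunc ℂ

instance : Field Kq := inferInstanceAs (Field (RatFunc ℂ))

/-- The indeterminate `q ∈ ℂ(q)`. -/
def q : Kq := (RatFunc.X : RatFunc ℂ)

theorem q_ne_zero : q ≠ 0 := RatFunc.X_ne_zero (K := ℂ)

theorem q_sub_ne_zero : q - q⁻¹ ≠ 0 := by
  intro h
  have h1 : q * q = 1 := by
    have := q_ne_zero
    field_simp at h
    linear_combination h
  have h2 : (Polynomial.X * Polynomial.X : Polynomial ℂ) = 1 := by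
    apply RatFunc.algebraMap_injective ℂ
    rw [map_mul, RatFunc.algebraMap_X, map_one]
    exact h1
  have h3 := congrArg Polynomial.natDegree h2
  simp at h3

section Uq

/-- The generators of `U_q(sl₂)`; `Ki` is the inverse of `K`. -/
inductive UqGen | E | F | K | Ki

open FreeAlgebra in
/-- The defining relations of `U_q(sl₂)`. -/
inductive UqRel : FreeAlgebra Kq UqGen → FreeAlgebra Kq UqGen → Prop
  | K_Ki : UqRel (ι Kq .K * ι Kq .Ki) 1
  | Ki_K : UqRel (ι Kq .Ki * ι Kq .K) 1
  | K_E : UqRel (ι Kq .K * ι Kq .E * ι Kq .Ki) (q ^ 2 • ι Kq .E)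
  | K_F : UqRel (ι Kq .K * ι Kq .F * ι Kq .Ki) ((q ^ 2)⁻¹ • ι Kq .F)
  | E_F : UqRel (ι Kq .E * ι Kq .F - ι Kq .F * ι Kq .E)
      ((q - q⁻¹)⁻¹ • (ι Kq .K - ι Kq .Ki))

/-- The quantized enveloping algebra `U_q(sl₂)` over `ℂ(q)`. -/
def Uq : Type := RingQuot UqRel

instance : Ring Uq := inferInstanceAs (Ring (RingQuot UqRel))
instance : Algebra Kq Uq := inferInstanceAs (Algebra Kq (RingQuot UqRel))

namespace Uq

/-- The quotient map from the free algebra. -/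
def mk : FreeAlgebra Kq UqGen →ₐ[Kq] Uq := RingQuot.mkAlgHom Kq UqRel
theorem mk_rel {x y : FreeAlgebra Kq UqGen} (h : UqRel x y) : mk x = mk y :=
  RingQuot.mkAlgHom_rel Kq h

/-- The image of a generator in `U_q(sl₂)`. -/
def gen (g : UqGen) : Uq := mk (FreeAlgebra.ι Kq g)
def E : Uq := gen .E
def F : Uq := gen .F
def K : Uq := gen .K
/-- The inverse of `K`. -/
def Ki : Uq := gen .Ki

theorem K_mul_Ki : K * Ki = 1 := by
  simpa [K, Ki, gen] using mk_rel UqRel.K_Ki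
theorem Ki_mul_K : Ki * K = 1 := by
  simpa [K, Ki, gen] using mk_rel UqRel.Ki_K
theorem K_E_Ki : K * E * Ki = q ^ 2 • E := by
  simpa [K, Ki, E, gen] using mk_rel UqRel.K_E
theorem K_F_Ki : K * F * Ki = (q ^ 2)⁻¹ • F := by
  simpa [K, Ki, F, gen] using mk_rel UqRel.K_F
theorem E_F : E * F - F * E = (q - q⁻¹)⁻¹ • (K - Ki) := by
  simpa [K, Ki, E, F, gen] using mk_rel UqRel.E_F

theorem K_mul_E : K * E = q ^ 2 • (E * K) := by
  rw [← smul_mul_assoc, ← K_E_Ki, mul_assoc (K * E), Ki_mul_K, mul_one]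
theorem K_mul_F : K * F = (q ^ 2)⁻¹ • (F * K) := by
  rw [← smul_mul_assoc, ← K_F_Ki, mul_assoc (K * F), Ki_mul_K, mul_one]
theorem E_mul_Ki : E * Ki = q ^ 2 • (Ki * E) := by
  have := congrArg (Ki * ·) K_E_Ki
  simpa [← mul_assoc, Ki_mul_K] using this
theorem F_mul_Ki : F * Ki = (q ^ 2)⁻¹ • (Ki * F) := by
  have := congrArg (Ki * ·) K_F_Ki
  simpa [← mul_assoc, Ki_mul_K] using this
theorem Ki_mul_E : Ki * E = (q ^ 2)⁻¹ • (E * Ki) := by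
  rw [E_mul_Ki, smul_smul, inv_mul_cancel₀ (pow_ne_zero 2 q_ne_zero), one_smul]
theorem Ki_mul_F : Ki * F = q ^ 2 • (F * Ki) := by
  rw [F_mul_Ki, smul_smul, mul_inv_cancel₀ (pow_ne_zero 2 q_ne_zero), one_smul]
theorem E_mul_F : E * F = F * E + (q - q⁻¹)⁻¹ • (K - Ki) := by
  rw [← E_F]; abel

section lift
variable {A : Type*} [Ring A] [Algebra Kq A]

/-- The algebra map out of `U_q(sl₂)` determined by the images of the generators. -/
def lift (e f k ki : A) (h1 : k * ki = 1) (h2 : ki * k = 1) (h3 : k * e * ki = q ^ 2 • e)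
    (h4 : k * f * ki = (q ^ 2)⁻¹ • f) (h5 : e * f - f * e = (q - q⁻¹)⁻¹ • (k - ki)) :
    Uq →ₐ[Kq] A :=
  RingQuot.liftAlgHom Kq ⟨FreeAlgebra.lift Kq
    (fun g => match g with | .E => e | .F => f | .K => k | .Ki => ki), by
      intro x y r
      cases r <;> simp [h1, h2, h3, h4, h5]⟩

variable {e f k ki : A} (h1 : k * ki = 1) (h2 : ki * k = 1) (h3 : k * e * ki = q ^ 2 • e)
    (h4 : k * f * ki = (q ^ 2)⁻¹ • f) (h5 : e * f - f * e = (q - q⁻¹)⁻¹ • (k - ki))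

@[simp] theorem lift_E : lift e f k ki h1 h2 h3 h4 h5 E = e := by
  simp only [lift, E, gen, mk]; erw [RingQuot.liftAlgHom_mkAlgHom_apply]; simp
@[simp] theorem lift_F : lift e f k ki h1 h2 h3 h4 h5 F = f := by
  simp only [lift, F, gen, mk]; erw [RingQuot.liftAlgHom_mkAlgHom_apply]; simp
@[simp] theorem lift_K : lift e f k ki h1 h2 h3 h4 h5 K = k := by
  simp only [lift, K, gen, mk]; erw [RingQuot.liftAlgHom_mkAlgHom_apply]; simp
@[simp] theorem lift_Ki : lift e f k ki h1 h2 h3 h4 h5 Ki = ki := by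
  simp only [lift, Ki, gen, mk]; erw [RingQuot.liftAlgHom_mkAlgHom_apply]; simp

theorem hom_ext {φ ψ : Uq →ₐ[Kq] A} (hE : φ E = ψ E) (hF : φ F = ψ F) (hK : φ K = ψ K)
    (hKi : φ Ki = ψ Ki) : φ = ψ := by
  refine RingQuot.ringQuot_ext' (S := Kq) (s := UqRel) φ ψ ?_
  apply FreeAlgebra.hom_ext
  funext g
  cases g
  · exact hE
  · exact hF
  · exact hK
  · exact hKi
end lift

theorem induction {p : Uq → Prop} (hs : ∀ r : Kq, p (algebraMap Kq Uq r)) (hE : p E) (hF : p F)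
    (hK : p K) (hKi : p Ki) (ha : ∀ x y, p x → p y → p (x + y))
    (hm : ∀ x y, p x → p y → p (x * y)) (x : Uq) : p x := by
  obtain ⟨y, rfl⟩ : ∃ y, mk y = x := RingQuot.mkAlgHom_surjective Kq UqRel x
  induction y using FreeAlgebra.induction with
  | grade0 r => rw [AlgHom.commutes]; exact hs r
  | grade1 g => cases g <;> assumption
  | mul a b ha hb => rw [map_mul]; exact hm _ _ ha hb
  | add a b ha' hb => rw [map_add]; exact ha _ _ ha' hb

/-- `ΔE = E ⊗ K + 1 ⊗ E`, `ΔF = F ⊗ 1 + K⁻¹ ⊗ F`, `ΔK = K ⊗ K`. -/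
def comulHom : Uq →ₐ[Kq] Uq ⊗[Kq] Uq :=
  lift (E ⊗ₜ K + 1 ⊗ₜ E) (F ⊗ₜ 1 + Ki ⊗ₜ F) (K ⊗ₜ K) (Ki ⊗ₜ Ki)
    (by simp [K_mul_Ki, Algebra.TensorProduct.one_def])
    (by simp [Ki_mul_K, Algebra.TensorProduct.one_def])
    (by simp [mul_add, add_mul, K_mul_Ki, K_E_Ki, TensorProduct.smul_tmul', mul_assoc K K Ki])
    (by simp [mul_add, add_mul, K_mul_Ki, K_F_Ki, TensorProduct.smul_tmul'])
    (by
      simp only [mul_add, add_mul, Algebra.TensorProduct.tmul_mul_tmul, mul_one, one_mul,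
        E_mul_F, E_mul_Ki, K_mul_F, TensorProduct.smul_tmul', TensorProduct.tmul_smul,
        TensorProduct.tmul_add, TensorProduct.add_tmul, smul_smul,
        inv_mul_cancel₀ (pow_ne_zero 2 q_ne_zero), one_smul, smul_sub, TensorProduct.tmul_sub,
        TensorProduct.sub_tmul]
      abel)

/-- `εE = εF = 0`, `εK = 1`. -/
def counitHom : Uq →ₐ[Kq] Kq :=
  lift 0 0 1 1 (by simp) (by simp) (by simp) (by simp) (by simp)

instance : Bialgebra Kq Uq := Bialgebra.ofAlgHom comulHom counitHom
  (by apply hom_ext <;> simp [comulHom, Algebra.TensorProduct.one_def, TensorProduct.add_tmul, TensorProduct.tmul_add, add_assoc])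
  (by apply hom_ext <;> simp [comulHom, counitHom, Algebra.TensorProduct.one_def])
  (by apply hom_ext <;> simp [comulHom, counitHom, Algebra.TensorProduct.one_def])

theorem comul_apply (x : Uq) : Coalgebra.comul (R := Kq) x = comulHom x := rfl
theorem counit_apply (x : Uq) : Coalgebra.counit (R := Kq) x = counitHom x := rfl

/-- The antipode: `SE = -EK⁻¹`, `SF = -KF`, `SK = K⁻¹`. -/
def antipodeHom : Uq →ₐ[Kq] Uqᵐᵒᵖ :=
  lift (.op (-(E * Ki))) (.op (-(K * F))) (.op Ki) (.op K)
    (by rw [← MulOpposite.op_mul, K_mul_Ki]; rfl)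
    (by rw [← MulOpposite.op_mul, Ki_mul_K]; rfl)
    (by
      rw [← MulOpposite.op_mul, ← MulOpposite.op_mul, ← MulOpposite.op_smul]
      congr 1
      rw [neg_mul, mul_neg, smul_neg, ← mul_assoc, ← mul_assoc, K_E_Ki, smul_mul_assoc])
    (by
      rw [← MulOpposite.op_mul, ← MulOpposite.op_mul, ← MulOpposite.op_smul]
      congr 1
      rw [neg_mul, mul_neg, smul_neg, K_F_Ki, mul_smul_comm])
    (by
      rw [← MulOpposite.op_mul, ← MulOpposite.op_mul, ← MulOpposite.op_sub,
        ← MulOpposite.op_sub, ← MulOpposite.op_smul]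
      congr 1
      have h1 : K * F * (E * Ki) = F * E := by
        have : K * F * (E * Ki) = (K * F * Ki) * (K * E * Ki) := by
          rw [mul_assoc (K * F) Ki, mul_assoc K E Ki, ← mul_assoc Ki K, Ki_mul_K, one_mul]
        rw [this, K_F_Ki, K_E_Ki, smul_mul_smul_comm, inv_mul_cancel₀ (pow_ne_zero 2 q_ne_zero),
          one_smul]
      have h2 : E * Ki * (K * F) = E * F := by
        rw [mul_assoc, ← mul_assoc Ki, Ki_mul_K, one_mul]
      rw [neg_mul_neg, neg_mul_neg, h1, h2, ← neg_sub (E * F), E_F, ← smul_neg, neg_sub])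

/-- The antipode as a linear map. -/
def antipodeLin : Uq →ₗ[Kq] Uq :=
  (MulOpposite.opLinearEquiv Kq).symm.toLinearMap ∘ₗ antipodeHom.toLinearMap

theorem antipodeLin_mul (x y : Uq) : antipodeLin (x * y) = antipodeLin y * antipodeLin x := by
  simp [antipodeLin]
theorem antipodeLin_algebraMap (r : Kq) :
    antipodeLin (algebraMap Kq Uq r) = algebraMap Kq Uq r := by
  simp [antipodeLin]
@[simp] theorem antipodeLin_one : antipodeLin 1 = 1 := by
  simp [antipodeLin]
@[simp] theorem antipodeLin_E : antipodeLin E = -(E * Ki) := by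
  simp [antipodeLin, antipodeHom]
@[simp] theorem antipodeLin_F : antipodeLin F = -(K * F) := by
  simp [antipodeLin, antipodeHom]
@[simp] theorem antipodeLin_K : antipodeLin K = Ki := by
  simp [antipodeLin, antipodeHom]
@[simp] theorem antipodeLin_Ki : antipodeLin Ki = K := by
  simp [antipodeLin, antipodeHom]

@[simp] theorem comul_E : Coalgebra.comul (R := Kq) E = E ⊗ₜ K + 1 ⊗ₜ E := by
  simp [comul_apply, comulHom]
@[simp] theorem comul_F : Coalgebra.comul (R := Kq) F = F ⊗ₜ 1 + Ki ⊗ₜ F := by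
  simp [comul_apply, comulHom]
@[simp] theorem comul_K : Coalgebra.comul (R := Kq) K = K ⊗ₜ K := by
  simp [comul_apply, comulHom]
@[simp] theorem comul_Ki : Coalgebra.comul (R := Kq) Ki = Ki ⊗ₜ Ki := by
  simp [comul_apply, comulHom]
@[simp] theorem counit_E : Coalgebra.counit (R := Kq) E = 0 := by
  simp [counit_apply, counitHom]
@[simp] theorem counit_F : Coalgebra.counit (R := Kq) F = 0 := by
  simp [counit_apply, counitHom]
@[simp] theorem counit_K : Coalgebra.counit (R := Kq) K = 1 := by
  simp [counit_apply, counitHom]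
@[simp] theorem counit_Ki : Coalgebra.counit (R := Kq) Ki = 1 := by
  simp [counit_apply, counitHom]

theorem antipode_left (x : Uq) :
    LinearMap.mul' Kq Uq (antipodeLin.rTensor Uq (Coalgebra.comul (R := Kq) x)) =
      algebraMap Kq Uq (Coalgebra.counit (R := Kq) x) := by
  induction x using induction with
  | hs r => simp [Algebra.TensorProduct.algebraMap_apply, antipodeLin_algebraMap]
  | hE => simp [mul_assoc, Ki_mul_K]
  | hF => simp [← mul_assoc]
  | hK => simp [Ki_mul_K]
  | hKi => simp [K_mul_Ki]
  | ha x y hx hy => simp only [map_add, hx, hy]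
  | hm x y hx hy =>
    have key : ∀ t u : Uq ⊗[Kq] Uq, ∀ r : Kq,
        LinearMap.mul' Kq Uq (antipodeLin.rTensor Uq t) = algebraMap Kq Uq r →
        LinearMap.mul' Kq Uq (antipodeLin.rTensor Uq (t * u)) =
          r • LinearMap.mul' Kq Uq (antipodeLin.rTensor Uq u) := by
      intro t u r hr
      induction u using TensorProduct.induction_on with
      | zero => simp
      | add u v hu hv => simp only [map_add, mul_add, hu, hv, smul_add]
      | tmul a b =>
        have : LinearMap.mul' Kq Uq (antipodeLin.rTensor Uq (t * a ⊗ₜ b)) =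
            antipodeLin a * LinearMap.mul' Kq Uq (antipodeLin.rTensor Uq t) * b := by
          clear hr
          induction t using TensorProduct.induction_on with
          | zero => simp
          | add u v hu hv => simp only [map_add, mul_add, add_mul, hu, hv]
          | tmul c d => simp [antipodeLin_mul, mul_assoc]
        rw [this, hr]
        simp [Algebra.algebraMap_eq_smul_one]
    rw [Bialgebra.comul_mul, key _ _ _ hx, hy, Bialgebra.counit_mul, map_mul,
      Algebra.smul_def]

theorem antipode_right (x : Uq) :
    LinearMap.mul' Kq Uq (antipodeLin.lTensor Uq (Coalgebra.comul (R := Kq) x)) =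
      algebraMap Kq Uq (Coalgebra.counit (R := Kq) x) := by
  induction x using induction with
  | hs r => simp [Algebra.TensorProduct.algebraMap_apply]
  | hE => simp
  | hF => simp [← mul_assoc, Ki_mul_K]
  | hK => simp [K_mul_Ki]
  | hKi => simp [Ki_mul_K]
  | ha x y hx hy => simp only [map_add, hx, hy]
  | hm x y hx hy =>
    have key : ∀ t u : Uq ⊗[Kq] Uq, ∀ r : Kq,
        LinearMap.mul' Kq Uq (antipodeLin.lTensor Uq u) = algebraMap Kq Uq r →
        LinearMap.mul' Kq Uq (antipodeLin.lTensor Uq (t * u)) =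
          r • LinearMap.mul' Kq Uq (antipodeLin.lTensor Uq t) := by
      intro t u r hr
      induction t using TensorProduct.induction_on with
      | zero => simp
      | add t v hu hv => simp only [map_add, add_mul, hu, hv, smul_add]
      | tmul a b =>
        have : LinearMap.mul' Kq Uq (antipodeLin.lTensor Uq (a ⊗ₜ b * u)) =
            a * LinearMap.mul' Kq Uq (antipodeLin.lTensor Uq u) * antipodeLin b := by
          clear hr
          induction u using TensorProduct.induction_on with
          | zero => simp
          | add u v hu hv => simp only [map_add, mul_add, add_mul, hu, hv]
          | tmul c d => simp [antipodeLin_mul, mul_assoc]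
        rw [this, hr]
        simp [Algebra.algebraMap_eq_smul_one]
    rw [Bialgebra.comul_mul, key _ _ _ hy, hx, Bialgebra.counit_mul,
      Algebra.smul_def, ← map_mul,
      mul_comm (Coalgebra.counit (R := Kq) y)]

instance : HopfAlgebra Kq Uq where
  antipode := antipodeLin
  mul_antipode_rTensor_comul := LinearMap.ext antipode_left
  mul_antipode_lTensor_comul := LinearMap.ext antipode_right

end Uq
end Uq

section Cq

/-- The generators of `ℂ_q[SL₂]`. -/
inductive CqGen | a | b | c | d

open FreeAlgebra in
/-- The defining relations of `ℂ_q[SL₂]`. -/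
inductive CqRel : FreeAlgebra Kq CqGen → FreeAlgebra Kq CqGen → Prop
  | b_a : CqRel (ι Kq .b * ι Kq .a) (q • (ι Kq .a * ι Kq .b))
  | c_a : CqRel (ι Kq .c * ι Kq .a) (q • (ι Kq .a * ι Kq .c))
  | d_b : CqRel (ι Kq .d * ι Kq .b) (q • (ι Kq .b * ι Kq .d))
  | d_c : CqRel (ι Kq .d * ι Kq .c) (q • (ι Kq .c * ι Kq .d))
  | c_b : CqRel (ι Kq .c * ι Kq .b) (ι Kq .b * ι Kq .c)
  | a_d : CqRel (ι Kq .a * ι Kq .d - q⁻¹ • (ι Kq .b * ι Kq .c)) 1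
  | d_a : CqRel (ι Kq .d * ι Kq .a - q • (ι Kq .b * ι Kq .c)) 1

/-- The quantized coordinate algebra `ℂ_q[SL₂]` over `ℂ(q)`. -/
def Cq : Type := RingQuot CqRel

instance : Ring Cq := inferInstanceAs (Ring (RingQuot CqRel))
instance : Algebra Kq Cq := inferInstanceAs (Algebra Kq (RingQuot CqRel))

namespace Cq

/-- The quotient map from the free algebra. -/
def mk : FreeAlgebra Kq CqGen →ₐ[Kq] Cq := RingQuot.mkAlgHom Kq CqRel
theorem mk_rel {x y : FreeAlgebra Kq CqGen} (h : CqRel x y) : mk x = mk y :=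
  RingQuot.mkAlgHom_rel Kq h

/-- The image of a generator in `ℂ_q[SL₂]`. -/
def gen (g : CqGen) : Cq := mk (FreeAlgebra.ι Kq g)
def a : Cq := gen .a
def b : Cq := gen .b
def c : Cq := gen .c
def d : Cq := gen .d

theorem b_a : b * a = q • (a * b) := by simpa [a, b, gen] using mk_rel CqRel.b_a
theorem c_a : c * a = q • (a * c) := by simpa [a, c, gen] using mk_rel CqRel.c_a
theorem d_b : d * b = q • (b * d) := by simpa [b, d, gen] using mk_rel CqRel.d_b
theorem d_c : d * c = q • (c * d) := by simpa [c, d, gen] using mk_rel CqRel.d_c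
theorem c_b : c * b = b * c := by simpa [b, c, gen] using mk_rel CqRel.c_b
theorem a_d : a * d = 1 + q⁻¹ • (b * c) := by
  rw [← sub_eq_iff_eq_add]; simpa [a, b, c, d, gen] using mk_rel CqRel.a_d
theorem d_a : d * a = 1 + q • (b * c) := by
  rw [← sub_eq_iff_eq_add]; simpa [a, b, c, d, gen] using mk_rel CqRel.d_a

section lift
variable {A : Type*} [Ring A] [Algebra Kq A]

/-- The algebra map out of `ℂ_q[SL₂]` determined by the images of the generators. -/
def lift (a b c d : A) (h1 : b * a = q • (a * b)) (h2 : c * a = q • (a * c))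
    (h3 : d * b = q • (b * d)) (h4 : d * c = q • (c * d)) (h5 : c * b = b * c)
    (h6 : a * d - q⁻¹ • (b * c) = 1) (h7 : d * a - q • (b * c) = 1) : Cq →ₐ[Kq] A :=
  RingQuot.liftAlgHom Kq ⟨FreeAlgebra.lift Kq
    (fun g => match g with | .a => a | .b => b | .c => c | .d => d), by
      intro x y r
      cases r <;> simp [h1, h2, h3, h4, h5, h6, h7]⟩

variable {a' b' c' d' : A} (h1 : b' * a' = q • (a' * b')) (h2 : c' * a' = q • (a' * c'))
    (h3 : d' * b' = q • (b' * d')) (h4 : d' * c' = q • (c' * d')) (h5 : c' * b' = b' * c')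
    (h6 : a' * d' - q⁻¹ • (b' * c') = 1) (h7 : d' * a' - q • (b' * c') = 1)

@[simp] theorem lift_a : lift a' b' c' d' h1 h2 h3 h4 h5 h6 h7 a = a' := by
  simp only [lift, a, gen, mk]; erw [RingQuot.liftAlgHom_mkAlgHom_apply]; simp
@[simp] theorem lift_b : lift a' b' c' d' h1 h2 h3 h4 h5 h6 h7 b = b' := by
  simp only [lift, b, gen, mk]; erw [RingQuot.liftAlgHom_mkAlgHom_apply]; simp
@[simp] theorem lift_c : lift a' b' c' d' h1 h2 h3 h4 h5 h6 h7 c = c' := by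
  simp only [lift, c, gen, mk]; erw [RingQuot.liftAlgHom_mkAlgHom_apply]; simp
@[simp] theorem lift_d : lift a' b' c' d' h1 h2 h3 h4 h5 h6 h7 d = d' := by
  simp only [lift, d, gen, mk]; erw [RingQuot.liftAlgHom_mkAlgHom_apply]; simp

theorem hom_ext {φ ψ : Cq →ₐ[Kq] A} (ha : φ a = ψ a) (hb : φ b = ψ b) (hc : φ c = ψ c)
    (hd : φ d = ψ d) : φ = ψ := by
  refine RingQuot.ringQuot_ext' (S := Kq) (s := CqRel) φ ψ ?_
  apply FreeAlgebra.hom_ext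
  funext g
  cases g
  · exact ha
  · exact hb
  · exact hc
  · exact hd
end lift

theorem induction {p : Cq → Prop} (hs : ∀ r : Kq, p (algebraMap Kq Cq r)) (ha : p a) (hb : p b)
    (hc : p c) (hd : p d) (hadd : ∀ x y, p x → p y → p (x + y))
    (hm : ∀ x y, p x → p y → p (x * y)) (x : Cq) : p x := by
  obtain ⟨y, rfl⟩ : ∃ y, mk y = x := RingQuot.mkAlgHom_surjective Kq CqRel x
  induction y using FreeAlgebra.induction with
  | grade0 r => rw [AlgHom.commutes]; exact hs r
  | grade1 g => cases g <;> assumption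
  | mul a b ha hb => rw [map_mul]; exact hm _ _ ha hb
  | add a b ha' hb => rw [map_add]; exact hadd _ _ ha' hb

theorem comul_relations {k A : Type*} [Field k] [Ring A] [Algebra k A] {a b c d : A} {r : k}
    (hr : r ≠ 0) (b_a : b * a = r • (a * b)) (c_a : c * a = r • (a * c)) (d_b : d * b = r • (b * d))
    (d_c : d * c = r • (c * d)) (c_b : c * b = b * c) (a_d : a * d = 1 + r⁻¹ • (b * c))
    (d_a : d * a = 1 + r • (b * c)) :
    (a ⊗ₜ b + b ⊗ₜ d) * (a ⊗ₜ a + b ⊗ₜ c) = r • ((a ⊗ₜ a + b ⊗ₜ c) * (a ⊗ₜ b + b ⊗ₜ d) : A ⊗[k] A) ∧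
    (c ⊗ₜ a + d ⊗ₜ c) * (a ⊗ₜ a + b ⊗ₜ c) = r • ((a ⊗ₜ a + b ⊗ₜ c) * (c ⊗ₜ a + d ⊗ₜ c) : A ⊗[k] A) ∧
    (c ⊗ₜ b + d ⊗ₜ d) * (a ⊗ₜ b + b ⊗ₜ d) = r • ((a ⊗ₜ b + b ⊗ₜ d) * (c ⊗ₜ b + d ⊗ₜ d) : A ⊗[k] A) ∧
    (c ⊗ₜ b + d ⊗ₜ d) * (c ⊗ₜ a + d ⊗ₜ c) = r • ((c ⊗ₜ a + d ⊗ₜ c) * (c ⊗ₜ b + d ⊗ₜ d) : A ⊗[k] A) ∧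
    (c ⊗ₜ a + d ⊗ₜ c) * (a ⊗ₜ b + b ⊗ₜ d) = ((a ⊗ₜ b + b ⊗ₜ d) * (c ⊗ₜ a + d ⊗ₜ c) : A ⊗[k] A) ∧
    (a ⊗ₜ a + b ⊗ₜ c) * (c ⊗ₜ b + d ⊗ₜ d) - r⁻¹ • ((a ⊗ₜ b + b ⊗ₜ d) * (c ⊗ₜ a + d ⊗ₜ c) : A ⊗[k] A) = 1 ∧
    (c ⊗ₜ b + d ⊗ₜ d) * (a ⊗ₜ a + b ⊗ₜ c) - r • ((a ⊗ₜ b + b ⊗ₜ d) * (c ⊗ₜ a + d ⊗ₜ c) : A ⊗[k] A) = 1 := by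
  refine ⟨?_, ?_, ?_, ?_, ?_, ?_, ?_⟩ <;>
  · simp only [mul_add, add_mul, Algebra.TensorProduct.tmul_mul_tmul, b_a, c_a, d_b, d_c, c_b,
        d_a, a_d, TensorProduct.tmul_add, TensorProduct.add_tmul, ← TensorProduct.smul_tmul',
        TensorProduct.tmul_smul, Algebra.TensorProduct.one_def, smul_add, smul_smul]
    match_scalars <;> field_simp <;> ring

/-- Matrix comultiplication: `Δ X_{ij} = ∑ₖ X_{ik} ⊗ X_{kj}` for `X = (a b; c d)`. -/
def comulHom : Cq →ₐ[Kq] Cq ⊗[Kq] Cq :=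
  lift (a ⊗ₜ a + b ⊗ₜ c) (a ⊗ₜ b + b ⊗ₜ d) (c ⊗ₜ a + d ⊗ₜ c) (c ⊗ₜ b + d ⊗ₜ d)
    (comul_relations q_ne_zero b_a c_a d_b d_c c_b a_d d_a).1
    (comul_relations q_ne_zero b_a c_a d_b d_c c_b a_d d_a).2.1
    (comul_relations q_ne_zero b_a c_a d_b d_c c_b a_d d_a).2.2.1
    (comul_relations q_ne_zero b_a c_a d_b d_c c_b a_d d_a).2.2.2.1
    (comul_relations q_ne_zero b_a c_a d_b d_c c_b a_d d_a).2.2.2.2.1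
    (comul_relations q_ne_zero b_a c_a d_b d_c c_b a_d d_a).2.2.2.2.2.1
    (comul_relations q_ne_zero b_a c_a d_b d_c c_b a_d d_a).2.2.2.2.2.2

/-- `ε X_{ij} = δ_{ij}`. -/
def counitHom : Cq →ₐ[Kq] Kq :=
  lift 1 0 0 1 (by simp) (by simp) (by simp) (by simp) (by simp) (by simp) (by simp)

instance : Bialgebra Kq Cq := Bialgebra.ofAlgHom comulHom counitHom
  (by apply hom_ext <;> simp [comulHom, TensorProduct.add_tmul, TensorProduct.tmul_add] <;> abel)
  (by apply hom_ext <;> simp [comulHom, counitHom])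
  (by apply hom_ext <;> simp [comulHom, counitHom])

theorem comul_apply (x : Cq) : Coalgebra.comul (R := Kq) x = comulHom x := rfl
theorem counit_apply (x : Cq) : Coalgebra.counit (R := Kq) x = counitHom x := rfl

@[simp] theorem comul_a : Coalgebra.comul (R := Kq) a = a ⊗ₜ a + b ⊗ₜ c := by
  simp [comul_apply, comulHom]
@[simp] theorem comul_b : Coalgebra.comul (R := Kq) b = a ⊗ₜ b + b ⊗ₜ d := by
  simp [comul_apply, comulHom]
@[simp] theorem comul_c : Coalgebra.comul (R := Kq) c = c ⊗ₜ a + d ⊗ₜ c := by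
  simp [comul_apply, comulHom]
@[simp] theorem comul_d : Coalgebra.comul (R := Kq) d = c ⊗ₜ b + d ⊗ₜ d := by
  simp [comul_apply, comulHom]
@[simp] theorem counit_a : Coalgebra.counit (R := Kq) a = 1 := by simp [counit_apply, counitHom]
@[simp] theorem counit_b : Coalgebra.counit (R := Kq) b = 0 := by simp [counit_apply, counitHom]
@[simp] theorem counit_c : Coalgebra.counit (R := Kq) c = 0 := by simp [counit_apply, counitHom]
@[simp] theorem counit_d : Coalgebra.counit (R := Kq) d = 1 := by simp [counit_apply, counitHom]

end Cq
end Cq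

section Pair

open Matrix Coalgebra
open scoped Kronecker

/-- The vector representation of `U_q(sl₂)`: `ρ(E) = e₁₂`, `ρ(F) = e₂₁`, `ρ(K) = diag(q, q⁻¹)`. -/
def ρ : Uq →ₐ[Kq] Matrix (Fin 2) (Fin 2) Kq :=
  Uq.lift !![0, 1; 0, 0] !![0, 0; 1, 0] !![q, 0; 0, q⁻¹] !![q⁻¹, 0; 0, q]
    (by have := q_ne_zero; ext i j; fin_cases i <;> fin_cases j <;> simp [this])
    (by have := q_ne_zero; ext i j; fin_cases i <;> fin_cases j <;> simp [this])
    (by have := q_ne_zero; ext i j; fin_cases i <;> fin_cases j <;> simp [pow_two])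
    (by have := q_ne_zero; ext i j; fin_cases i <;> fin_cases j <;> simp [pow_two])
    (by
      have := q_sub_ne_zero
      have h : q⁻¹ - q ≠ 0 := fun h => this (by linear_combination -h)
      ext i j; fin_cases i <;> fin_cases j <;> simp [this]
      rw [← neg_sub q, mul_neg, inv_mul_cancel₀ this])

@[simp] theorem ρ_E : ρ Uq.E = !![0, 1; 0, 0] := by simp [ρ]
@[simp] theorem ρ_F : ρ Uq.F = !![0, 0; 1, 0] := by simp [ρ]
@[simp] theorem ρ_K : ρ Uq.K = !![q, 0; 0, q⁻¹] := by simp [ρ]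
@[simp] theorem ρ_Ki : ρ Uq.Ki = !![q⁻¹, 0; 0, q] := by simp [ρ]

/-- `2 × 2` matrices over `ℂ(q)`. -/
abbrev Mat₂ : Type := Matrix (Fin 2) (Fin 2) Kq
/-- Endomorphisms of `ℂ(q)² ⊗ ℂ(q)²`, as matrices indexed by pairs. -/
abbrev Mat₄ : Type := Matrix (Fin 2 × Fin 2) (Fin 2 × Fin 2) Kq

/-- The Kronecker product as an algebra map. -/
def kron : Mat₂ ⊗[Kq] Mat₂ →ₐ[Kq] Mat₄ :=
  (Matrix.kroneckerAlgEquiv (Fin 2) (Fin 2) Kq).toAlgHom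

@[simp] theorem kron_tmul (a b : Mat₂) : kron (a ⊗ₜ b) = a ⊗ₖ b := rfl

/-- The tensor square of the vector representation. -/
def Θ : Uq →ₐ[Kq] Mat₄ :=
  kron.comp ((Algebra.TensorProduct.map ρ ρ).comp (Bialgebra.comulAlgHom Kq Uq))

theorem Θ_E : Θ Uq.E = ρ Uq.E ⊗ₖ ρ Uq.K + 1 ⊗ₖ ρ Uq.E := by simp [Θ]
theorem Θ_F : Θ Uq.F = ρ Uq.F ⊗ₖ 1 + ρ Uq.Ki ⊗ₖ ρ Uq.F := by simp [Θ]
theorem Θ_K : Θ Uq.K = ρ Uq.K ⊗ₖ ρ Uq.K := by simp [Θ]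
theorem Θ_Ki : Θ Uq.Ki = ρ Uq.Ki ⊗ₖ ρ Uq.Ki := by simp [Θ]

/-- The matrix coefficient `h ↦ ρ(h)_{ij}`. -/
def coeff (i j : Fin 2) : Uq →ₗ[Kq] Kq := Matrix.entryLinearMap Kq Kq i j ∘ₗ ρ.toLinearMap

@[simp] theorem coeff_apply (i j : Fin 2) (h : Uq) : coeff i j h = ρ h i j := rfl

/-- The element of the convolution algebra of `U_q(sl₂)` given by a matrix coefficient. -/
def cv (i j : Fin 2) : WithConv (Uq →ₗ[Kq] Kq) := WithConv.toConv (coeff i j)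

theorem cv_mul (i j k l : Fin 2) (h : Uq) : (cv i j * cv k l) h = Θ h (i, k) (j, l) := by
  rw [LinearMap.convMul_apply]
  change _ = kron (Algebra.TensorProduct.map ρ ρ (comul (R := Kq) h)) (i, k) (j, l)
  generalize comul (R := Kq) h = t
  induction t using TensorProduct.induction_on with
  | zero => simp
  | add t u ht hu => simp only [map_add, ht, hu, Matrix.add_apply]
  | tmul x y => simp [cv]

/-- The `q`-invariant vector. -/
def wq : Fin 2 × Fin 2 → Kq := fun p => !![0, -q; 1, 0] p.1 p.2

theorem Θ_wq (h : Uq) : Θ h *ᵥ wq = counit (R := Kq) h • wq ∧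
    wq ᵥ* Θ h = counit (R := Kq) h • wq := by
  have hq := q_ne_zero
  induction h using Uq.induction with
  | hs r => simp [Algebra.algebraMap_eq_smul_one, Matrix.smul_mulVec, Matrix.vecMul_smul]
  | hE =>
    rw [Θ_E]
    constructor <;> ext ⟨i, j⟩ <;> fin_cases i <;> fin_cases j <;>
      simp [Matrix.mulVec, Matrix.vecMul, dotProduct, Fintype.sum_prod_type, wq, hq]
  | hF =>
    rw [Θ_F]
    constructor <;> ext ⟨i, j⟩ <;> fin_cases i <;> fin_cases j <;>
      simp [Matrix.mulVec, Matrix.vecMul, dotProduct, Fintype.sum_prod_type, wq, hq]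
  | hK =>
    rw [Θ_K]
    constructor <;> ext ⟨i, j⟩ <;> fin_cases i <;> fin_cases j <;>
      simp [Matrix.mulVec, Matrix.vecMul, dotProduct, Fintype.sum_prod_type, wq, hq]
  | hKi =>
    rw [Θ_Ki]
    constructor <;> ext ⟨i, j⟩ <;> fin_cases i <;> fin_cases j <;>
      simp [Matrix.mulVec, Matrix.vecMul, dotProduct, Fintype.sum_prod_type, wq, hq]
  | ha x y hx hy =>
    simp only [map_add, Matrix.add_mulVec, Matrix.vecMul_add, hx, hy, add_smul, and_self]
  | hm x y hx hy =>
    simp only [map_mul, Bialgebra.counit_mul, ← Matrix.mulVec_mulVec, ← Matrix.vecMul_vecMul, hx,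
      hy, Matrix.mulVec_smul, Matrix.smul_vecMul, smul_smul, mul_comm, and_self]

theorem cv_rel_row (i k : Fin 2) :
    cv i 1 * cv k 0 - q • (cv i 0 * cv k 1) = algebraMap Kq _ (wq (i, k)) := by
  apply WithConv.ext; ext h
  have := congrFun (Θ_wq h).1 (i, k)
  simp only [mulVec, dotProduct, Fintype.sum_prod_type, Fin.sum_univ_two, wq] at this
  change (cv i 1 * cv k 0) h - q • ((cv i 0 * cv k 1) h) = wq (i, k) • counit h
  rw [cv_mul, cv_mul]
  simp [wq] at this ⊢
  linear_combination this

theorem cv_rel_col (i k : Fin 2) :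
    cv 1 i * cv 0 k - q • (cv 0 i * cv 1 k) = algebraMap Kq _ (wq (i, k)) := by
  apply WithConv.ext; ext h
  have := congrFun (Θ_wq h).2 (i, k)
  simp only [vecMul, dotProduct, Fintype.sum_prod_type, Fin.sum_univ_two, wq] at this
  change (cv 1 i * cv 0 k) h - q • ((cv 0 i * cv 1 k) h) = wq (i, k) • counit h
  rw [cv_mul, cv_mul]
  simp [wq] at this ⊢
  linear_combination this

theorem cv_c_b : cv 1 0 * cv 0 1 = cv 0 1 * cv 1 0 := by
  have h := (cv_rel_col 0 1).trans (cv_rel_row 0 1).symm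
  exact sub_left_injective h

/-- The algebra map `ℂ_q[SL₂] → U_q(sl₂)^*` which sends `X_{ij}` to the matrix coefficient
`h ↦ ρ(h)_{ij}`. -/
def pairHom : Cq →ₐ[Kq] WithConv (Uq →ₗ[Kq] Kq) :=
  Cq.lift (cv 0 0) (cv 0 1) (cv 1 0) (cv 1 1)
    (sub_eq_zero.1 <| by simpa [wq] using cv_rel_row 0 0)
    (sub_eq_zero.1 <| by simpa [wq] using cv_rel_col 0 0)
    (sub_eq_zero.1 <| by simpa [wq] using cv_rel_col 1 1)
    (sub_eq_zero.1 <| by simpa [wq] using cv_rel_row 1 1)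
    cv_c_b
    (by
      have h : q⁻¹ • (cv 0 1 * cv 1 0 - q • (cv 0 0 * cv 1 1)) =
          q⁻¹ • algebraMap Kq (WithConv (Uq →ₗ[Kq] Kq)) (-q) := by
        simpa [wq] using congrArg (q⁻¹ • ·) (cv_rel_row 0 1)
      rw [smul_sub, smul_smul, inv_mul_cancel₀ q_ne_zero, one_smul,
        Algebra.algebraMap_eq_smul_one, smul_smul, mul_neg, inv_mul_cancel₀ q_ne_zero] at h
      have h0 : (-1 : Kq) • (1 : WithConv (Uq →ₗ[Kq] Kq)) = -1 := by rw [neg_smul, one_smul]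
      rw [← neg_sub, h]
      exact (congrArg _ h0).trans (neg_neg _))
    (by
      rw [← cv_c_b]
      simpa [wq] using cv_rel_row 1 0)

@[simp] theorem pairHom_a : pairHom Cq.a = cv 0 0 := by simp [pairHom]
@[simp] theorem pairHom_b : pairHom Cq.b = cv 0 1 := by simp [pairHom]
@[simp] theorem pairHom_c : pairHom Cq.c = cv 1 0 := by simp [pairHom]
@[simp] theorem pairHom_d : pairHom Cq.d = cv 1 1 := by simp [pairHom]

/-- The bilinear form underlying the pairing between `ℂ_q[SL₂]` and `U_q(sl₂)`. -/
def pairLin : Cq →ₗ[Kq] Uq →ₗ[Kq] Kq :=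
  (WithConv.linearEquiv Kq (Uq →ₗ[Kq] Kq)).toLinearMap ∘ₗ pairHom.toLinearMap

theorem pairLin_apply (c : Cq) (h : Uq) : pairLin c h = pairHom c h := rfl

theorem pairLin_one (h : Uq) : pairLin 1 h = counit (R := Kq) h := by
  simp [pairLin_apply]

theorem pairLin_mul (c c' : Cq) (h : Uq) : pairLin (c * c') h =
    LinearMap.mul' Kq Kq (TensorProduct.map (pairLin c) (pairLin c') (comul (R := Kq) h)) := by
  rw [pairLin_apply, map_mul, LinearMap.convMul_apply]; rfl

theorem pairLin_apply_one (c : Cq) : pairLin c 1 = counit (R := Kq) c := by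
  induction c using Cq.induction with
  | hs r => simp [Algebra.algebraMap_eq_smul_one, pairLin_one]
  | ha => simp [pairLin_apply, cv]
  | hb => simp [pairLin_apply, cv]
  | hc => simp [pairLin_apply, cv]
  | hd => simp [pairLin_apply, cv]
  | hadd x y hx hy => simp only [map_add, LinearMap.add_apply, hx, hy]
  | hm x y hx hy => simp [pairLin_mul, Algebra.TensorProduct.one_def, hx, hy]

/-- `c ⊗ c' ⊗ (h ⊗ h') ↦ φ(c, h) φ(c', h')`. -/
def pair₂ : Cq ⊗[Kq] Cq →ₗ[Kq] Uq ⊗[Kq] Uq →ₗ[Kq] Kq :=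
  TensorProduct.lift ((TensorProduct.mapBilinear (RingHom.id Kq) Uq Uq Kq Kq).compl₁₂
    pairLin pairLin |>.compr₂ (LinearMap.llcomp Kq _ _ _ (LinearMap.mul' Kq Kq)))

@[simp] theorem pair₂_tmul (c c' : Cq) (t : Uq ⊗[Kq] Uq) : pair₂ (c ⊗ₜ c') t =
    LinearMap.mul' Kq Kq (TensorProduct.map (pairLin c) (pairLin c') t) := by
  simp [pair₂]

theorem pairLin_apply_mul (c : Cq) (h h' : Uq) :
    pairLin c (h * h') = pair₂ (comul (R := Kq) c) (h ⊗ₜ h') := by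
  induction c using Cq.induction generalizing h h' with
  | hs r => simp [Algebra.algebraMap_eq_smul_one, pairLin_one, Algebra.TensorProduct.one_def]
  | ha => simp [pairLin_apply, cv, Matrix.mul_apply]
  | hb => simp [pairLin_apply, cv, Matrix.mul_apply]
  | hc => simp [pairLin_apply, cv, Matrix.mul_apply]
  | hd => simp [pairLin_apply, cv, Matrix.mul_apply]
  | hadd x y hx hy => simp only [map_add, LinearMap.add_apply, hx, hy]
  | hm x y hx hy =>
    have e1 : ∀ s t : Uq ⊗[Kq] Uq,
        LinearMap.mul' Kq Kq (TensorProduct.map (pairLin x) (pairLin y) (s * t)) =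
        LinearMap.mul' Kq Kq (TensorProduct.map (pair₂ (comul (R := Kq) x))
          (pair₂ (comul (R := Kq) y))
          (TensorProduct.tensorTensorTensorComm Kq Uq Uq Uq Uq (s ⊗ₜ t))) := by
      intro s t
      induction s using TensorProduct.induction_on with
      | zero => simp
      | add s u hs hu => simp only [map_add, add_mul, TensorProduct.add_tmul, hs, hu]
      | tmul s₁ s₂ =>
        induction t using TensorProduct.induction_on with
        | zero => simp
        | add s u hs hu => simp only [map_add, mul_add, TensorProduct.tmul_add, hs, hu]
        | tmul t₁ t₂ => simp [hx, hy]
    have e2 : ∀ u v : Cq ⊗[Kq] Cq, pair₂ (u * v) (h ⊗ₜ h') =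
        LinearMap.mul' Kq Kq (TensorProduct.map (pair₂ u) (pair₂ v)
          (TensorProduct.tensorTensorTensorComm Kq Uq Uq Uq Uq
            (comul (R := Kq) h ⊗ₜ comul (R := Kq) h'))) := by
      intro u v
      induction u using TensorProduct.induction_on with
      | zero => simp
      | add s u hs hu =>
        simp only [map_add, add_mul, TensorProduct.map_add_left, LinearMap.add_apply, hs, hu]
      | tmul x₁ x₂ =>
        induction v using TensorProduct.induction_on with
        | zero => simp
        | add s u hs hu =>
          simp only [map_add, mul_add, TensorProduct.map_add_right, LinearMap.add_apply, hs, hu]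
        | tmul y₁ y₂ =>
          simp only [Algebra.TensorProduct.tmul_mul_tmul, pair₂_tmul, TensorProduct.map_tmul,
            LinearMap.mul'_apply, pairLin_mul]
          generalize comul (R := Kq) h = s
          generalize comul (R := Kq) h' = t
          induction s using TensorProduct.induction_on with
          | zero => simp
          | add s u hs hu => simp only [map_add, add_mul, TensorProduct.add_tmul, hs, hu]
          | tmul s₁ s₂ =>
            induction t using TensorProduct.induction_on with
            | zero => simp
            | add s u hs hu => simp only [map_add, mul_add, TensorProduct.tmul_add, hs, hu]
            | tmul t₁ t₂ =>
              simp
              ring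
    rw [pairLin_mul, Bialgebra.comul_mul, Bialgebra.comul_mul, e1, e2]

/-- The pairing of bialgebras between `ℂ_q[SL₂]` and `U_q(sl₂)` with
`φ(X_{ij}, h) = ρ(h)_{ij}`. -/
def pairing : Pairing Kq Cq Uq where
  φ := pairLin
  map_mul_right c h h' := by
    rw [pairLin_apply_mul]
    generalize comul (R := Kq) c = t
    induction t using TensorProduct.induction_on with
    | zero => simp
    | add t u ht hu => simp only [map_add, LinearMap.add_apply, ht, hu]
    | tmul x y => simp
  map_mul_left := pairLin_mul
  map_one_left := pairLin_one
  map_one_right := pairLin_apply_one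

end Pair

section DoubleLift
variable {k C H A : Type*} [Field k] [Ring C] [Ring H] [Bialgebra k C] [HopfAlgebra k H]
  [Ring A] [Algebra k A]

namespace Double

/-- `c ⊗ h ↦ γ(c) θ(h)`. -/
def liftLin (γ : C →ₐ[k] Aᵐᵒᵖ) (θ : H →ₐ[k] A) : C ⊗[k] H →ₗ[k] A :=
  TensorProduct.lift ((LinearMap.mul k A).compl₁₂
    ((MulOpposite.opLinearEquiv k).symm.toLinearMap ∘ₗ γ.toLinearMap) θ.toLinearMap)

@[simp] theorem liftLin_tmul (γ : C →ₐ[k] Aᵐᵒᵖ) (θ : H →ₐ[k] A) (c : C) (h : H) :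
    liftLin γ θ (c ⊗ₜ h) = (γ c).unop * θ h := by
  simp [liftLin]

theorem liftLin_mulC (γ : C →ₐ[k] Aᵐᵒᵖ) (θ : H →ₐ[k] A) (c : C) (z : C ⊗[k] H) :
    liftLin γ θ (Pairing.mulC c z) = (γ c).unop * liftLin γ θ z := by
  induction z using TensorProduct.induction_on with
  | zero => simp
  | add t u ht hu => simp only [map_add, mul_add, ht, hu]
  | tmul c' h => simp [mul_assoc]

theorem liftLin_rmulH (γ : C →ₐ[k] Aᵐᵒᵖ) (θ : H →ₐ[k] A) (h : H) (z : C ⊗[k] H) :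
    liftLin γ θ (Pairing.rmulH h z) = liftLin γ θ z * θ h := by
  induction z using TensorProduct.induction_on with
  | zero => simp
  | add t u ht hu => simp only [map_add, add_mul, ht, hu]
  | tmul c' h => simp [mul_assoc, Pairing.rmulH]

variable (P : Pairing k C H)

/-- Compatibility of an action of `C` (with opposite multiplication) and of an action of `H` with
the cross-relation of the quantum double. -/
def Compat (γ : C →ₐ[k] Aᵐᵒᵖ) (θ : H →ₐ[k] A) (h : H) (c : C) : Prop :=
  θ h * (γ c).unop = liftLin γ θ (P.mulH h (c ⊗ₜ 1))

variable {P} {γ : C →ₐ[k] Aᵐᵒᵖ} {θ : H →ₐ[k] A}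

theorem Compat.tmul {h : H} {c : C} (hc : Compat P γ θ h c) (y : H) :
    θ h * liftLin γ θ (c ⊗ₜ y) = liftLin γ θ (P.mulH h (c ⊗ₜ y)) := by
  have e : (c ⊗ₜ y : C ⊗[k] H) = Pairing.rmulH y (c ⊗ₜ 1) := by simp [Pairing.rmulH]
  rw [liftLin_tmul, ← mul_assoc, hc, e, P.mulH_rmulH, liftLin_rmulH]

theorem Compat.mulD {c : C} (hc : ∀ h, Compat P γ θ h c) (z : C ⊗[k] H) :
    liftLin γ θ z * (γ c).unop = liftLin γ θ (P.mulD z (c ⊗ₜ 1)) := by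
  induction z using TensorProduct.induction_on with
  | zero => simp
  | add t u ht hu => simp only [map_add, LinearMap.add_apply, add_mul, ht, hu]
  | tmul c' h => rw [liftLin_tmul, mul_assoc, hc h, P.mulD_tmul, liftLin_mulC]

theorem Compat.mul_right {c c' : C} (hc : ∀ h, Compat P γ θ h c) (hc' : ∀ h, Compat P γ θ h c')
    (h : H) : Compat P γ θ h (c * c') := by
  have e : ((c * c') ⊗ₜ 1 : C ⊗[k] H) = Pairing.mulC c' (c ⊗ₜ 1) := by simp
  have e' : P.mulH h (Pairing.mulC c' (c ⊗ₜ 1)) = P.mulD (P.mulH h (c' ⊗ₜ 1)) (c ⊗ₜ 1) := by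
    rw [← P.mulH_mulC]; rfl
  rw [Compat, map_mul, MulOpposite.unop_mul, ← mul_assoc, hc' h, Compat.mulD hc, e, e']

variable (P γ θ) in
/-- The algebra map out of the quantum double determined by compatible actions. -/
def lift (hc : ∀ h c, Compat P γ θ h c) : Double P →ₐ[k] A :=
  AlgHom.ofLinearMap (liftLin γ θ ∘ₗ (ofTensor P).symm.toLinearMap)
    (by simp [one_def])
    (by
      intro x y
      rw [mul_def]
      simp only [LinearMap.comp_apply, LinearEquiv.coe_coe, LinearEquiv.symm_apply_apply]
      generalize (ofTensor P).symm x = x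
      generalize (ofTensor P).symm y = y
      induction x using TensorProduct.induction_on with
      | zero => simp
      | add t u ht hu => simp only [map_add, LinearMap.add_apply, add_mul, ht, hu]
      | tmul c h =>
        rw [P.mulD_tmul, liftLin_mulC, liftLin_tmul, mul_assoc]
        congr 1
        induction y using TensorProduct.induction_on with
        | zero => simp
        | add t u ht hu => simp only [map_add, mul_add, ht, hu]
        | tmul c' h' => exact ((hc h c').tmul h').symm)

end Double

end DoubleLift

section V₁₁

open Matrix Coalgebra
open scoped Kronecker

/-- `q^{1/2} R` for the universal `R`-matrix evaluated on `ℂ(q)² ⊗ ℂ(q)²`,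
`q^{1/2} R = q^{1/2} q^{H ⊗ H / 2} (1 + (q - q⁻¹) ρ(E) ⊗ ρ(F))`. -/
def Rplus : Mat₄ :=
  Matrix.diagonal (fun p => if p.1 = p.2 then q else 1) * (1 + (q - q⁻¹) • ρ Uq.E ⊗ₖ ρ Uq.F)

/-- `q^{-1/2} R⁻¹`, the inverse of `q^{1/2} R`. -/
def Rminus : Mat₄ :=
  (1 - (q - q⁻¹) • ρ Uq.E ⊗ₖ ρ Uq.F) * Matrix.diagonal (fun p => if p.1 = p.2 then q⁻¹ else 1)

theorem Rplus_mul_Rminus : Rplus * Rminus = 1 := by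
  have hq := q_ne_zero
  have h1 : (1 + (q - q⁻¹) • ρ Uq.E ⊗ₖ ρ Uq.F) * (1 - (q - q⁻¹) • ρ Uq.E ⊗ₖ ρ Uq.F) =
      (1 : Mat₄) := by
    have : (ρ Uq.E ⊗ₖ ρ Uq.F) * (ρ Uq.E ⊗ₖ ρ Uq.F) = (0 : Mat₄) := by
      have h : ρ Uq.E * ρ Uq.E = 0 := by ext i j; fin_cases i <;> fin_cases j <;> simp
      rw [← Matrix.mul_kronecker_mul, h, Matrix.zero_kronecker]
    rw [mul_sub, mul_one, add_mul, one_mul, smul_mul_smul_comm, this, smul_zero, add_zero,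
      add_sub_cancel_right]
  have h2 : Matrix.diagonal (fun p : Fin 2 × Fin 2 => if p.1 = p.2 then q else 1) *
      Matrix.diagonal (fun p => if p.1 = p.2 then q⁻¹ else 1) = (1 : Mat₄) := by
    rw [Matrix.diagonal_mul_diagonal, ← Matrix.diagonal_one]
    congr 1; funext p; split_ifs <;> simp [hq]
  rw [Rplus, Rminus, mul_assoc, ← mul_assoc _ _ (Matrix.diagonal _), h1, one_mul, h2]

/-- The action of `X_{kl}` on `V₁⁺`, by `(id ⊗ X_{kl})(R)`, multiplied by `q^{1/2}`. -/
def actPlus (k l : Fin 2) : Mat₂ := Matrix.of fun i j => Rplus (i, k) (j, l)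

/-- The action of `X_{kl}` on `V₁⁻`, by `(X_{kl} ⊗ id)(R⁻¹)`, multiplied by `q^{-1/2}`. -/
def actMinus (k l : Fin 2) : Mat₂ := Matrix.of fun i j => Rminus (k, i) (l, j)

/-- The action of `X_{kl}` on `V₁⁺ ⊗ V₁⁻`, through `Δ X_{kl} = ∑ₘ X_{km} ⊗ X_{ml}`. The factors `q^{1/2}`
and `q^{-1/2}` of the two tensor factors cancel, so no square root of `q` is needed. -/
def actX (k l : Fin 2) : Mat₄ := ∑ m, actPlus k m ⊗ₖ actMinus m l

theorem actPlus_00 : actPlus 0 0 = !![q, 0; 0, 1] := by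
  ext i j; fin_cases i <;> fin_cases j <;>
    simp [actPlus, Rplus, Matrix.mul_apply, Matrix.diagonal_apply,
      Matrix.one_apply]
theorem actPlus_01 : actPlus 0 1 = 0 := by
  ext i j; fin_cases i <;> fin_cases j <;>
    simp [actPlus, Rplus, Matrix.mul_apply, Matrix.diagonal_apply,
      Matrix.one_apply]
theorem actPlus_10 : actPlus 1 0 = !![0, q - q⁻¹; 0, 0] := by
  ext i j; fin_cases i <;> fin_cases j <;>
    simp [actPlus, Rplus, Matrix.mul_apply, Matrix.diagonal_apply,
      Matrix.one_apply]
theorem actPlus_11 : actPlus 1 1 = !![1, 0; 0, q] := by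
  ext i j; fin_cases i <;> fin_cases j <;>
    simp [actPlus, Rplus, Matrix.mul_apply, Matrix.diagonal_apply,
      Matrix.one_apply]
theorem actMinus_00 : actMinus 0 0 = !![q⁻¹, 0; 0, 1] := by
  ext i j; fin_cases i <;> fin_cases j <;>
    simp [actMinus, Rminus, Matrix.mul_apply, Matrix.diagonal_apply,
      Matrix.one_apply]
theorem actMinus_01 : actMinus 0 1 = !![0, 0; -(q - q⁻¹), 0] := by
  ext i j; fin_cases i <;> fin_cases j <;>
    simp [actMinus, Rminus, Matrix.mul_apply, Matrix.diagonal_apply,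
      Matrix.one_apply]
theorem actMinus_10 : actMinus 1 0 = 0 := by
  ext i j; fin_cases i <;> fin_cases j <;>
    simp [actMinus, Rminus, Matrix.mul_apply, Matrix.diagonal_apply,
      Matrix.one_apply]
theorem actMinus_11 : actMinus 1 1 = !![1, 0; 0, q⁻¹] := by
  ext i j; fin_cases i <;> fin_cases j <;>
    simp [actMinus, Rminus, Matrix.mul_apply, Matrix.diagonal_apply,
      Matrix.one_apply]

theorem actX_00 : actX 0 0 = !![q, 0; 0, 1] ⊗ₖ !![q⁻¹, 0; 0, 1] := by
  simp [actX, actPlus_00, actPlus_01, actMinus_00, actMinus_10]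
theorem actX_01 : actX 0 1 = !![q, 0; 0, 1] ⊗ₖ !![0, 0; -(q - q⁻¹), 0] := by
  simp [actX, actPlus_00, actPlus_01, actMinus_01, actMinus_11]
theorem actX_10 : actX 1 0 = !![0, q - q⁻¹; 0, 0] ⊗ₖ !![q⁻¹, 0; 0, 1] := by
  simp [actX, actPlus_10, actPlus_11, actMinus_00, actMinus_10]
theorem actX_11 : actX 1 1 = !![0, q - q⁻¹; 0, 0] ⊗ₖ !![0, 0; -(q - q⁻¹), 0] +
    !![1, 0; 0, q] ⊗ₖ !![1, 0; 0, q⁻¹] := by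
  simp [actX, actPlus_10, actPlus_11, actMinus_01, actMinus_11]

theorem actX_relations :
    actX 0 0 * actX 0 1 = q • (actX 0 1 * actX 0 0) ∧
    actX 0 0 * actX 1 0 = q • (actX 1 0 * actX 0 0) ∧
    actX 0 1 * actX 1 1 = q • (actX 1 1 * actX 0 1) ∧
    actX 1 0 * actX 1 1 = q • (actX 1 1 * actX 1 0) ∧
    actX 0 1 * actX 1 0 = actX 1 0 * actX 0 1 ∧
    actX 1 1 * actX 0 0 - q⁻¹ • (actX 1 0 * actX 0 1) = 1 ∧
    actX 0 0 * actX 1 1 - q • (actX 1 0 * actX 0 1) = 1 := by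
  have hq := q_ne_zero
  rw [actX_00, actX_01, actX_10, actX_11]
  refine ⟨?_, ?_, ?_, ?_, ?_, ?_, ?_⟩ <;> (rw [← Matrix.ext_iff]) <;>
    simp [Prod.forall, Fin.forall_fin_two, Matrix.mul_apply, Fintype.sum_prod_type, hq] <;>
    try (field_simp) <;> try and_intros <;> first | trivial | ring1

/-- The action of `ℂ_q[SL₂]`, with opposite multiplication, on `V₁⁺ ⊗ V₁⁻`. -/
def γ : Cq →ₐ[Kq] Mat₄ᵐᵒᵖ :=
  Cq.lift (.op (actX 0 0)) (.op (actX 0 1)) (.op (actX 1 0)) (.op (actX 1 1))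
    (congrArg MulOpposite.op actX_relations.1)
    (congrArg MulOpposite.op actX_relations.2.1)
    (congrArg MulOpposite.op actX_relations.2.2.1)
    (congrArg MulOpposite.op actX_relations.2.2.2.1)
    (congrArg MulOpposite.op actX_relations.2.2.2.2.1)
    (congrArg MulOpposite.op actX_relations.2.2.2.2.2.1)
    (congrArg MulOpposite.op actX_relations.2.2.2.2.2.2)

/-- The generators of `ℂ_q[SL₂]` as a matrix. -/
def X (i j : Fin 2) : Cq := !![Cq.a, Cq.b; Cq.c, Cq.d] i j

theorem γ_X (i j : Fin 2) : (γ (X i j)).unop = actX i j := by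
  fin_cases i <;> fin_cases j <;> simp [γ, X]

theorem comul_X (i j : Fin 2) : comul (R := Kq) (X i j) = ∑ k, X i k ⊗ₜ[Kq] X k j := by
  fin_cases i <;> fin_cases j <;> simp [X]

theorem pairing_X (i j : Fin 2) (h : Uq) : pairing.φ (X i j) h = ρ h i j := by
  change pairHom (X i j) h = _
  fin_cases i <;> fin_cases j <;> simp [X, cv]

theorem lact_X (h : Uq) (i j : Fin 2) : pairing.lact h (X i j) = ∑ k, ρ h k j • X i k := by
  simp [Pairing.lact_apply, comul_X, pairing_X]

theorem ract_X (h : Uq) (i j : Fin 2) : pairing.ract h (X i j) = ∑ k, ρ h i k • X k j := by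
  simp [Pairing.ract_apply, comul_X, pairing_X]

/-- The span of the elements `X_{ij} ⊗ y`. -/
def spanX : Submodule Kq (Cq ⊗[Kq] Uq) := Submodule.span Kq {z | ∃ i j y, z = X i j ⊗ₜ y}

theorem mem_spanX (i j : Fin 2) (y : Uq) : X i j ⊗ₜ y ∈ spanX :=
  Submodule.subset_span ⟨i, j, y, rfl⟩

theorem mulH_mem_spanX (h : Uq) (i j : Fin 2) (y : Uq) :
    pairing.mulH h (X i j ⊗ₜ y) ∈ spanX := by
  rw [Pairing.mulH, LinearMap.comp_apply]
  generalize comul₂ (k := Kq) h = t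
  induction t using TensorProduct.induction_on with
  | zero => simp
  | add t u ht hu => simpa only [map_add, LinearMap.add_apply] using add_mem ht hu
  | tmul u w =>
    induction w using TensorProduct.induction_on with
    | zero => simp
    | add t u ht hu =>
      simpa only [map_add, TensorProduct.tmul_add, LinearMap.add_apply] using add_mem ht hu
    | tmul v w =>
      simp only [Pairing.twist_tmul, ract_X, lact_X, map_sum, map_smul, TensorProduct.sum_tmul,
        Finset.smul_sum, ← TensorProduct.smul_tmul']
      exact sum_mem fun _ _ => sum_mem fun _ _ => Submodule.smul_mem _ _
        (Submodule.smul_mem _ _ (mem_spanX _ _ _))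

theorem antipode_eq (h : Uq) : HopfAlgebra.antipode Kq h = Uq.antipodeLin h := rfl

theorem liftLin_twist (x y z : Uq) (i j : Fin 2) :
    Double.liftLin γ Θ (pairing.twist (x ⊗ₜ (y ⊗ₜ z)) (X i j ⊗ₜ 1)) =
      (∑ k, ∑ l, (ρ (Uq.antipodeLin x) i k * ρ z l j) • actX k l) * Θ y := by
  rw [Pairing.twist_tmul, antipode_eq, ract_X]
  simp only [map_sum, map_smul, lact_X, Finset.smul_sum, smul_smul, TensorProduct.sum_tmul,
    ← TensorProduct.smul_tmul', Double.liftLin_tmul, γ_X, mul_one, Finset.sum_mul,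
    smul_mul_assoc]

set_option linter.unusedSimpArgs false in
theorem compat_E (i j : Fin 2) : Double.Compat pairing γ Θ Uq.E (X i j) := by
  have hq := q_ne_zero
  have e : comul₂ (k := Kq) Uq.E = Uq.E ⊗ₜ (Uq.K ⊗ₜ Uq.K) + 1 ⊗ₜ (Uq.E ⊗ₜ Uq.K) +
      1 ⊗ₜ (1 ⊗ₜ Uq.E) := by
    simp [comul₂, TensorProduct.tmul_add, add_assoc, Algebra.TensorProduct.one_def]
  rw [Double.Compat, γ_X, Pairing.mulH, LinearMap.comp_apply, e]
  simp only [map_add, LinearMap.add_apply, liftLin_twist, Uq.antipodeLin_one, Uq.antipodeLin_E,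
    map_neg, map_mul, map_one, Θ_E, Θ_K, Fin.sum_univ_two, actX_00, actX_01, actX_10, actX_11,
    ρ_E, ρ_F, ρ_K, ρ_Ki]
  fin_cases i <;> fin_cases j <;>
    simp only [Fin.zero_eta, Fin.mk_one, actX_00, actX_01, actX_10, actX_11, add_mul, mul_add,
      smul_add, smul_mul_assoc, mul_smul_comm, ← Matrix.mul_kronecker_mul, Matrix.one_fin_two,
      Matrix.mul_fin_two] <;>
    rw [← Matrix.ext_iff] <;>
    simp [Prod.forall, Fin.forall_fin_two, hq] <;>
    try (field_simp) <;> try and_intros <;> first | trivial | ring1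

set_option linter.unusedSimpArgs false in
theorem compat_F (i j : Fin 2) : Double.Compat pairing γ Θ Uq.F (X i j) := by
  have hq := q_ne_zero
  have e : comul₂ (k := Kq) Uq.F = Uq.F ⊗ₜ (1 ⊗ₜ 1) + Uq.Ki ⊗ₜ (Uq.F ⊗ₜ 1) +
      Uq.Ki ⊗ₜ (Uq.Ki ⊗ₜ Uq.F) := by
    simp [comul₂, TensorProduct.tmul_add, add_assoc, Algebra.TensorProduct.one_def]
  rw [Double.Compat, γ_X, Pairing.mulH, LinearMap.comp_apply, e]
  simp only [map_add, LinearMap.add_apply, liftLin_twist, Uq.antipodeLin_one, Uq.antipodeLin_F, Uq.antipodeLin_Ki,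
    map_neg, map_mul, map_one, Θ_F, Θ_Ki, Fin.sum_univ_two, actX_00, actX_01, actX_10, actX_11,
    ρ_E, ρ_F, ρ_K, ρ_Ki]
  fin_cases i <;> fin_cases j <;>
    simp only [Fin.zero_eta, Fin.mk_one, actX_00, actX_01, actX_10, actX_11, add_mul, mul_add,
      smul_add, smul_mul_assoc, mul_smul_comm, ← Matrix.mul_kronecker_mul, Matrix.one_fin_two,
      Matrix.mul_fin_two] <;>
    rw [← Matrix.ext_iff] <;>
    simp [Prod.forall, Fin.forall_fin_two, hq] <;>
    try (field_simp) <;> try and_intros <;> first | trivial | ring1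

set_option linter.unusedSimpArgs false in
theorem compat_K (i j : Fin 2) : Double.Compat pairing γ Θ Uq.K (X i j) := by
  have hq := q_ne_zero
  have e : comul₂ (k := Kq) Uq.K = Uq.K ⊗ₜ (Uq.K ⊗ₜ Uq.K) := by
    simp [comul₂, TensorProduct.tmul_add, add_assoc, Algebra.TensorProduct.one_def]
  rw [Double.Compat, γ_X, Pairing.mulH, LinearMap.comp_apply, e]
  simp only [map_add, LinearMap.add_apply, liftLin_twist, Uq.antipodeLin_one, Uq.antipodeLin_K,
    map_neg, map_mul, map_one, Θ_K, Fin.sum_univ_two, actX_00, actX_01, actX_10, actX_11,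
    ρ_E, ρ_F, ρ_K, ρ_Ki]
  fin_cases i <;> fin_cases j <;>
    simp only [Fin.zero_eta, Fin.mk_one, actX_00, actX_01, actX_10, actX_11, add_mul, mul_add,
      smul_add, smul_mul_assoc, mul_smul_comm, ← Matrix.mul_kronecker_mul, Matrix.one_fin_two,
      Matrix.mul_fin_two] <;>
    rw [← Matrix.ext_iff] <;>
    simp [Prod.forall, Fin.forall_fin_two, hq] <;>
    try (field_simp) <;> try and_intros <;> first | trivial | ring1

set_option linter.unusedSimpArgs false in
theorem compat_Ki (i j : Fin 2) : Double.Compat pairing γ Θ Uq.Ki (X i j) := by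
  have hq := q_ne_zero
  have e : comul₂ (k := Kq) Uq.Ki = Uq.Ki ⊗ₜ (Uq.Ki ⊗ₜ Uq.Ki) := by
    simp [comul₂, TensorProduct.tmul_add, add_assoc, Algebra.TensorProduct.one_def]
  rw [Double.Compat, γ_X, Pairing.mulH, LinearMap.comp_apply, e]
  simp only [map_add, LinearMap.add_apply, liftLin_twist, Uq.antipodeLin_one, Uq.antipodeLin_Ki,
    map_neg, map_mul, map_one, Θ_Ki, Fin.sum_univ_two, actX_00, actX_01, actX_10, actX_11,
    ρ_E, ρ_F, ρ_K, ρ_Ki]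
  fin_cases i <;> fin_cases j <;>
    simp only [Fin.zero_eta, Fin.mk_one, actX_00, actX_01, actX_10, actX_11, add_mul, mul_add,
      smul_add, smul_mul_assoc, mul_smul_comm, ← Matrix.mul_kronecker_mul, Matrix.one_fin_two,
      Matrix.mul_fin_two] <;>
    rw [← Matrix.ext_iff] <;>
    simp [Prod.forall, Fin.forall_fin_two, hq] <;>
    try (field_simp) <;> try and_intros <;> first | trivial | ring1

theorem compat_X (h : Uq) : ∀ i j, Double.Compat pairing γ Θ h (X i j) := by
  induction h using Uq.induction with
  | hs r =>
    intro i j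
    simp [Double.Compat, Algebra.algebraMap_eq_smul_one, Pairing.mulH_one]
  | hE => exact compat_E
  | hF => exact compat_F
  | hK => exact compat_K
  | hKi => exact compat_Ki
  | ha x y hx hy =>
    intro i j
    have h1 := hx i j
    have h2 := hy i j
    simp only [Double.Compat, map_add, add_mul, LinearMap.add_apply] at *
    rw [h1, h2]
  | hm x y hx hy =>
    intro i j
    have key : ∀ z ∈ spanX, Θ x * Double.liftLin γ Θ z =
        Double.liftLin γ Θ (pairing.mulH x z) := by
      intro z hz
      induction hz using Submodule.span_induction with
      | mem z hz =>
        obtain ⟨i, j, y, rfl⟩ := hz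
        exact (hx i j).tmul y
      | zero => simp
      | add t u _ _ ht hu => simp only [map_add, mul_add, ht, hu]
      | smul r t _ ht => simp only [map_smul, mul_smul_comm, ht]
    rw [Double.Compat, map_mul, mul_assoc, hy i j, key _ (mulH_mem_spanX y i j 1),
      Pairing.mulH_mul]
    rfl

theorem compat (h : Uq) (c : Cq) : Double.Compat pairing γ Θ h c := by
  induction c using Cq.induction generalizing h with
  | hs r =>
    simp [Double.Compat, Algebra.algebraMap_eq_smul_one, ← TensorProduct.smul_tmul',
      Pairing.mulH_apply_one]
  | ha => exact compat_X h 0 0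
  | hb => exact compat_X h 0 1
  | hc => exact compat_X h 1 0
  | hd => exact compat_X h 1 1
  | hadd x y hx hy =>
    have h1 := hx h
    have h2 := hy h
    simp only [Double.Compat, map_add, TensorProduct.add_tmul, MulOpposite.unop_add,
      mul_add] at *
    rw [h1, h2]
  | hm x y hx hy => exact Double.Compat.mul_right hx hy h

/-- The action of the quantum double on `V₁⁺ ⊗ V₁⁻`, by matrices. -/
def actMat : Double pairing →ₐ[Kq] Mat₄ := Double.lift pairing γ Θ compat

end V₁₁

section H₁₁

open Double

/-- The `D(U_q(sl₂))`-module `V₁⁺ ⊗ V₁⁻`. -/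
def act : Double pairing →ₐ[Kq] Module.End Kq (Fin 2 × Fin 2 → Kq) :=
  (Matrix.toLinAlgEquiv' (R := Kq) (n := Fin 2 × Fin 2)).toAlgHom.comp actMat

/-- The bimodule `𝓗_{1,1} ⊆ D(U_q(sl₂))^*` of matrix coefficients of `V₁⁺ ⊗ V₁⁻`. -/
def H₁₁ : Submodule Kq (Module.Dual Kq (Double pairing)) := LinearMap.range (matrixCoeff act)

/-- The highest-weight bivectors of a subspace `W` of `D(U_q(sl₂))^*`: the elements `f ∈ W` with
`E ▸ f = 0 = f ◂ E`. -/
def hwBivectors (W : Submodule Kq (Module.Dual Kq (Double pairing))) :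
    Submodule Kq (Module.Dual Kq (Double pairing)) :=
  W ⊓ LinearMap.ker (dualLeft (k := Kq) (ofH pairing Uq.E)) ⊓
    LinearMap.ker (dualRight (k := Kq) (ofH pairing Uq.E))

/-- `f` is homogeneous of weight `(m, n)`: `K ▸ f = q^m f` and `f ◂ K⁻¹ = q^n f`. -/
def HasWeight (f : Module.Dual Kq (Double pairing)) (m n : ℤ) : Prop :=
  dualLeft (ofH pairing Uq.K) f = q ^ m • f ∧ dualRight (ofH pairing Uq.Ki) f = q ^ n • f

open Uq Cq in
/-- The Casimir element `Δ = EF + (q⁻¹ K + q K⁻¹) / (q - q⁻¹)²`. -/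
def casimir : Uq := E * F + ((q - q⁻¹) ^ 2)⁻¹ • (q⁻¹ • K + q • Ki)

open Uq Cq in
/-- `v₁ = (q - q⁻¹) E K⁻¹ ac - c²` -/
def v₁ : Uq ⊗[Kq] Cq := (q - q⁻¹) • ((E * Ki) ⊗ₜ (a * c)) - 1 ⊗ₜ (c ^ 2)

open Uq Cq in
/-- `v₂ = (q - q⁻¹) Δ ac - ((q + q⁻¹) / (q - q⁻¹)) K ac - q⁻² F K c² + E a²` -/
def v₂ : Uq ⊗[Kq] Cq :=
  (q - q⁻¹) • (casimir ⊗ₜ (a * c)) - ((q + q⁻¹) / (q - q⁻¹)) • (K ⊗ₜ (a * c))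
    - (q ^ 2)⁻¹ • ((F * K) ⊗ₜ (c ^ 2)) + E ⊗ₜ (a ^ 2)

open Uq Cq in
/-- `v₃ = E K⁻¹` -/
def v₃ : Uq ⊗[Kq] Cq := (E * Ki) ⊗ₜ 1

open Uq Cq in
/-- `v₄ = Δ` -/
def v₄ : Uq ⊗[Kq] Cq := casimir ⊗ₜ 1

open Uq Cq in
/-- The sixteen elements of `U_q(sl₂) ⊗ ℂ_q[SL₂]` which form a basis of `𝓗_{1,1}`. -/
def basisH₁₁ : Matrix (Fin 4) (Fin 4) (Uq ⊗[Kq] Cq) :=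
  !![v₃,
     Ki ⊗ₜ 1,
     F ⊗ₜ 1,
     v₄;
     v₁,
     (q - q⁻¹) • (Ki ⊗ₜ (a * c)),
     (q - q⁻¹) • (F ⊗ₜ (a * c)) + 1 ⊗ₜ (a ^ 2),
     v₂;
     (q⁻¹ - q) • ((E * Ki) ⊗ₜ (d * b)) + q • (1 ⊗ₜ (d ^ 2)),
     (q⁻¹ - q) • (Ki ⊗ₜ (d * b)),
     (q⁻¹ - q) • (F ⊗ₜ (d * b)) - q • (1 ⊗ₜ (b ^ 2)),
     (q⁻¹ - q) • (casimir ⊗ₜ (d * b)) + ((q + q⁻¹) / (q - q⁻¹)) • (K ⊗ₜ (d * b))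
       + q⁻¹ • ((F * K) ⊗ₜ (d ^ 2)) - q • (E ⊗ₜ (b ^ 2));
     (q - q⁻¹) • ((E * Ki) ⊗ₜ (b * c)) - 1 ⊗ₜ (d * c),
     (q - q⁻¹) • (Ki ⊗ₜ (b * c)),
     (q - q⁻¹) • (F ⊗ₜ (b * c)) + q • (1 ⊗ₜ (a * b)),
     (q - q⁻¹) • (casimir ⊗ₜ (b * c)) - ((q + q⁻¹) / (q - q⁻¹)) • (K ⊗ₜ (b * c))
       - (q ^ 2)⁻¹ • ((F * K) ⊗ₜ (d * c)) + q • (E ⊗ₜ (a * b)) - (q - q⁻¹)⁻¹ • (K ⊗ₜ 1)]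

end H₁₁

end QDouble

end

/-! Everything is transported to the algebra of 4 × 4 matrices. Let π = `actMat` be the action of
the double on V₁⁺ ⊗ V₁⁻. The matrix coefficients of this module are exactly the functionals x ↦ tr(Y
π(x)), the coefficient of v ⊗ ζ being the one with Y of rank one, Y = v ζ. Through Y ↦ tr(Y π(·))
the left action of x becomes left multiplication of Y by π(x), by cyclicity of the trace, and the
right action becomes right multiplication.

The decisive fact is that π is onto (`actMat_surjective`). The operators of K and of the generator a
are diagonal and together separate the four basis vectors, so the diagonal matrix units lie in the
image; the nonzero entries of E and F then yield all the others. Nondegeneracy of the trace makes Y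
↦ tr(Y π(·)) injective, hence the dimension is 16. Sub-bimodules become two-sided ideals of a matrix
algebra over a field, and such an algebra is simple.

To reach the explicit elements, each matrix coefficient is lifted to H ⊗ C. On c · h the action is
the matrix product of the action of c, whose entries are pairings of c with fixed elements of H
(`γ_apply`), and of the action of h, whose entries are pairings of h with quadratic monomials in C
(`Θ_apply`). The product is represented by `coeffTensor`. The sixteen listed elements then
correspond to rescaled products of one of four columns and one of four rows (`basisH₁₁_eq`), an
identity in H ⊗ C itself, so injectivity of `ι` is never needed. Columns and rows are bases, so
these products span all matrices.

A highest-weight bivector is a matrix Y with EY = 0 = YE. Both the kernel of E and the space of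
covectors killed by E are two-dimensional, spanned by the invariant vector and an extreme weight
vector; this leaves 2 · 2 = 4 products, which are the images of `v₁`, …, `v₄`. The weights are those
of the column and of the row. -/

noncomputable section

namespace QDouble

open Matrix Coalgebra Double
open scoped Kronecker

/-! ### L-operators and the lift of matrix coefficients to H ⊗ C -/

/-- The elements of `U_q(sl₂)` which represent, through the pairing, the matrix coefficients of the
action of `ℂ_q[SL₂]` on `V₁⁺ ⊗ V₁⁻`. -/
def Lop : Matrix (Fin 2 × Fin 2) (Fin 2 × Fin 2) Uq := Matrix.of fun p r =>
  !![!![1, 0; -(q * (q - q⁻¹)) • Uq.E, Uq.K],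
     !![(q⁻¹ * (q - q⁻¹)) • Uq.F, 0; -(q - q⁻¹) ^ 2 • (Uq.F * Uq.E), (q⁻¹ * (q - q⁻¹)) • (Uq.F * Uq.K)];
     0, !![Uq.Ki, 0; -(q⁻¹ * (q - q⁻¹)) • (Uq.E * Uq.Ki), 1]] p.1 r.1 p.2 r.2

theorem counit_Lop (p r : Fin 2 × Fin 2) :
    counit (R := Kq) (Lop p r) = (1 : Mat₄) p r := by
  obtain ⟨p₁, p₂⟩ := p
  obtain ⟨r₁, r₂⟩ := r
  fin_cases p₁ <;> fin_cases p₂ <;> fin_cases r₁ <;> fin_cases r₂ <;> simp [Lop]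

/-- The tensor factors stand in the order opposite to matrix multiplication because C acts through
its opposite algebra. This is the dual form of multiplicativity of that action: pairing a product of
two elements of C with an entry splits along this coproduct. -/
theorem comul_Lop (p r : Fin 2 × Fin 2) :
    comul (R := Kq) (Lop p r) = ∑ s, Lop s r ⊗ₜ[Kq] Lop p s := by
  have hq := q_ne_zero
  obtain ⟨p₁, p₂⟩ := p
  obtain ⟨r₁, r₂⟩ := r
  fin_cases p₁ <;> fin_cases p₂ <;> fin_cases r₁ <;> fin_cases r₂ <;>
    simp [Lop, Fintype.sum_prod_type, Algebra.TensorProduct.one_def, Uq.Ki_mul_E, Uq.K_mul_Ki, Uq.Ki_mul_K, add_mul, mul_add,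
      ← TensorProduct.smul_tmul', smul_smul, TensorProduct.neg_tmul, TensorProduct.tmul_neg] <;>
    match_scalars <;> field_simp

/-- Both sides are matrix-valued anti-homomorphisms in c, the right-hand one by `comul_Lop`, so it
suffices to compare them on the four generators (`key`). -/
theorem γ_apply (c : Cq) (p r : Fin 2 × Fin 2) :
    (γ c).unop p r = pairing.φ c (Lop p r) := by
  have key (p r : Fin 2 × Fin 2) (i j : Fin 2) : (γ (X i j)).unop p r = pairing.φ (X i j) (Lop p r) := by
    have hq := q_ne_zero
    rw [γ_X, pairing_X]
    obtain ⟨p₁, p₂⟩ := p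
    obtain ⟨r₁, r₂⟩ := r
    fin_cases p₁ <;> fin_cases p₂ <;> fin_cases r₁ <;> fin_cases r₂ <;>
      fin_cases i <;> fin_cases j <;>
      simp [Lop, actX_00, actX_01, actX_10, actX_11] <;> (try field_simp) <;> ring
  induction c using Cq.induction generalizing p r with
  | hs t =>
    simp [Algebra.algebraMap_eq_smul_one, pairing.map_one_left, counit_Lop]
  | ha => exact key p r 0 0
  | hb => exact key p r 0 1
  | hc => exact key p r 1 0
  | hd => exact key p r 1 1
  | hadd x y hx hy =>
    simp only [map_add, LinearMap.add_apply, MulOpposite.unop_add, Matrix.add_apply, hx, hy]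
  | hm x y hx hy =>
    rw [map_mul, MulOpposite.unop_mul, Matrix.mul_apply, pairing.map_mul_left, comul_Lop]
    simp [hx, hy, mul_comm]

/-- The elements of `U_q(sl₂) ⊗ ℂ_q[SL₂]` given by the matrix coefficients of `V₁⁺ ⊗ V₁⁻`. -/
def coeffTensor (p r : Fin 2 × Fin 2) : Uq ⊗[Kq] Cq :=
  ∑ t, Lop p t ⊗ₜ[Kq] (X t.1 r.1 * X t.2 r.2)

/-- A coefficient of the tensor square is a convolution product of two coefficients of the vector
representation, and `pairHom` sends products in C to convolution products. -/
theorem Θ_apply (h : Uq) (p r : Fin 2 × Fin 2) :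
    Θ h p r = pairing.φ (X p.1 r.1 * X p.2 r.2) h := by
  have hX (i j : Fin 2) : pairHom (X i j) = cv i j := by
    fin_cases i <;> fin_cases j <;> simp [X]
  change _ = pairHom (X p.1 r.1 * X p.2 r.2) h
  rw [map_mul, hX, hX, cv_mul]

/-- On c · h the action is `(γ c).unop * Θ h`; the index t in `coeffTensor` is the one contracted in
this matrix product. -/
theorem ι_coeffTensor (p r : Fin 2 × Fin 2) (x : Double pairing) :
    ι pairing (coeffTensor p r) x = actMat x p r := by
  obtain ⟨z, rfl⟩ := (ofTensor pairing).surjective x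
  have h : actMat (ofTensor pairing z) = liftLin γ Θ z := rfl
  rw [h]
  induction z using TensorProduct.induction_on with
  | zero => simp
  | add t u ht hu => simp only [map_add, Matrix.add_apply, ht rfl, hu rfl]
  | tmul c h =>
    simp [coeffTensor, ι_tmul, Matrix.mul_apply, γ_apply, Θ_apply]

/-! ### Matrix coefficients as trace forms -/

/-- The functional `x ↦ tr (Y · x)` on the quantum double, for `x` acting on `V₁⁺ ⊗ V₁⁻`. -/
def traceForm : Mat₄ →ₗ[Kq] Module.Dual Kq (Double pairing) :=
  LinearMap.mk₂ Kq (fun Y x => Matrix.trace (Y * actMat x))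
    (fun Y Z x => by simp [add_mul]) (fun s Y x => by simp)
    (fun Y x y => by simp [mul_add]) (fun s Y x => by simp)

theorem traceForm_apply (Y : Mat₄) (x : Double pairing) :
    traceForm Y x = Matrix.trace (Y * actMat x) := rfl

theorem traceForm_eq_sum (Y : Mat₄) :
    traceForm Y = ∑ r, ∑ p, Y r p • ι pairing (coeffTensor p r) := by
  ext x
  simp [traceForm_apply, ι_coeffTensor, Matrix.trace, Matrix.mul_apply]

/-- Cyclicity: tr(Y π(y) π(x)) = tr(π(x) Y π(y)). The right action below needs only associativity.
-/
theorem dualLeft_traceForm (x : Double pairing) (Y : Mat₄) :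
    dualLeft x (traceForm Y) = traceForm (actMat x * Y) := by
  ext y
  rw [dualLeft_apply, traceForm_apply, traceForm_apply, map_mul, ← mul_assoc, Matrix.trace_mul_comm,
    mul_assoc]

theorem dualRight_traceForm (x : Double pairing) (Y : Mat₄) :
    dualRight x (traceForm Y) = traceForm (Y * actMat x) := by
  ext y
  rw [dualRight_apply, traceForm_apply, traceForm_apply, map_mul, mul_assoc]

theorem actMat_ofH (h : Uq) : actMat (ofH pairing h) = Θ h := by
  change liftLin γ Θ (1 ⊗ₜ h) = Θ h
  simp

theorem actMat_ofC (c : Cq) : actMat (ofC pairing c) = (γ c).unop := by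
  change liftLin γ Θ (c ⊗ₜ 1) = _
  simp

/-- As q is an indeterminate, equality would identify polynomials of degrees n and 0. This supplies
the nonvanishing denominators later on. -/
theorem q_pow_ne_one {n : ℕ} (hn : n ≠ 0) : q ^ n ≠ 1 := by
  intro h
  have h2 : (Polynomial.X ^ n : Polynomial ℂ) = 1 := by
    apply RatFunc.algebraMap_injective ℂ
    rw [map_pow, RatFunc.algebraMap_X, map_one]
    exact h
  have h3 := congrArg Polynomial.natDegree h2
  simp [hn] at h3

/-- A pure tensor v ⊗ ζ corresponds to the rank-one matrix v ζ, since tr(v ζ A) = ζ(A v).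
Conversely, each matrix entry is the coefficient of a basis vector and a coordinate functional, and
trace forms are combinations of entries. -/
theorem range_matrixCoeff_act : H₁₁ = LinearMap.range traceForm := by
  apply le_antisymm
  · rintro _ ⟨t, rfl⟩
    induction t using TensorProduct.induction_on with
    | zero => simp
    | add t u ht hu => rw [map_add]; exact add_mem ht hu
    | tmul v ζ =>
      refine ⟨Matrix.vecMulVec v fun p => ζ (Pi.single p 1), ?_⟩
      ext x
      have e : ζ (act x v) = ∑ p, (actMat x *ᵥ v) p * ζ (Pi.single p 1) := by
        change ζ (actMat x *ᵥ v) = _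
        conv_lhs => rw [← Finset.univ_sum_single (actMat x *ᵥ v), map_sum]
        refine Finset.sum_congr rfl fun p _ => ?_
        rw [← smul_eq_mul, ← map_smul, ← Pi.single_smul, smul_eq_mul, mul_one]
      rw [matrixCoeff_tmul, traceForm_apply, e, Matrix.trace_mul_comm, Matrix.mul_vecMulVec, Matrix.trace_vecMulVec]
      rfl
  · rintro _ ⟨Y, rfl⟩
    rw [traceForm_eq_sum]
    refine sum_mem fun r _ => sum_mem fun p _ => Submodule.smul_mem _ _
      ⟨Pi.single r 1 ⊗ₜ LinearMap.proj p, ?_⟩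
    ext x
    rw [matrixCoeff_tmul, ι_coeffTensor]
    change (actMat x *ᵥ Pi.single r 1) p = _
    simp

/-! ### Surjectivity of the action onto 4 × 4 matrices -/

theorem Θ_K_eq : Θ Uq.K = Matrix.diagonal fun p => (!![q ^ 2, 1; 1, (q ^ 2)⁻¹] p.1 p.2) := by
  have hq := q_ne_zero
  ext ⟨i, j⟩ ⟨k, l⟩
  fin_cases i <;> fin_cases j <;> fin_cases k <;> fin_cases l <;> simp [Θ_K, hq, pow_two]

/-- The generator a takes the distinct values q and q⁻¹ on the two vectors of weight zero, which K
cannot tell apart. -/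
theorem actX_00_eq : actX 0 0 = Matrix.diagonal fun p => (!![1, q; q⁻¹, 1] p.1 p.2) := by
  have hq := q_ne_zero
  ext ⟨i, j⟩ ⟨k, l⟩
  fin_cases i <;> fin_cases j <;> fin_cases k <;> fin_cases l <;> simp [actX_00, hq]

/-- Diagonal matrix units come from Lagrange interpolation in K and a; the remaining ones come from
compressing E and F between diagonal units and composing through the top vector `(0, 0)`. -/
theorem single_mem_range_actMat (p r : Fin 2 × Fin 2) :
    (Matrix.single p r 1 : Mat₄) ∈ actMat.range := by
  have hq := q_ne_zero
  have hq2 : q ^ 2 - 1 ≠ 0 := sub_ne_zero.2 (q_pow_ne_one two_ne_zero)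
  have hq4 : q ^ 4 - 1 ≠ 0 := sub_ne_zero.2 (q_pow_ne_one four_ne_zero)
  have hE : Θ Uq.E ∈ actMat.range := ⟨_, actMat_ofH _⟩
  have hF : Θ Uq.F ∈ actMat.range := ⟨_, actMat_ofH _⟩
  have hK : Θ Uq.K ∈ actMat.range := ⟨_, actMat_ofH _⟩
  have hX : actX 0 0 ∈ actMat.range := ⟨_, (actMat_ofC (X 0 0)).trans (γ_X 0 0)⟩
  have h00 : (Matrix.single (0, 0) (0, 0) 1 : Mat₄) ∈ actMat.range := by
    -- Interpolation at the eigenvalue q² of K, whose other eigenvalues are 1 and q⁻²; the constant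
    -- is the inverse of (q² − 1)(q² − q⁻²).
    have e : (Matrix.single (0, 0) (0, 0) 1 : Mat₄) = (q ^ 2 / ((q ^ 2 - 1) * (q ^ 4 - 1))) •
        ((Θ Uq.K - 1) * (Θ Uq.K - (q ^ 2)⁻¹ • 1)) := by
      rw [Θ_K_eq]
      ext ⟨i, j⟩ ⟨k, l⟩
      fin_cases i <;> fin_cases j <;> fin_cases k <;> fin_cases l <;>
        simp [Matrix.mul_apply, Fintype.sum_prod_type, Matrix.one_apply]
      field_simp
    rw [e]
    exact Subalgebra.smul_mem _ (mul_mem (sub_mem hK (one_mem _))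
      (sub_mem hK (Subalgebra.smul_mem _ (one_mem _) _))) _
  have h11 : (Matrix.single (1, 1) (1, 1) 1 : Mat₄) ∈ actMat.range := by
    -- The same at the eigenvalue q⁻², with constant the inverse of (q⁻² − 1)(q⁻² − q²).
    have e : (Matrix.single (1, 1) (1, 1) 1 : Mat₄) = (q ^ 4 / ((q ^ 2 - 1) * (q ^ 4 - 1))) •
        ((Θ Uq.K - 1) * (Θ Uq.K - q ^ 2 • 1)) := by
      rw [Θ_K_eq]
      ext ⟨i, j⟩ ⟨k, l⟩
      fin_cases i <;> fin_cases j <;> fin_cases k <;> fin_cases l <;>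
        simp [Matrix.mul_apply, Fintype.sum_prod_type, Matrix.one_apply]
      field_simp
      ring
    rw [e]
    exact Subalgebra.smul_mem _ (mul_mem (sub_mem hK (one_mem _))
      (sub_mem hK (Subalgebra.smul_mem _ (one_mem _) _))) _
  have h01 : (Matrix.single (0, 1) (0, 1) 1 : Mat₄) ∈ actMat.range := by
    -- The last factor projects onto weight zero. There a − q⁻¹ kills the vector `(1, 0)` and is q −
    -- q⁻¹ = (q² − 1)/q on the vector `(0, 1)`.
    have e : (Matrix.single (0, 1) (0, 1) 1 : Mat₄) = (q / (q ^ 2 - 1)) •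
        ((actX 0 0 - q⁻¹ • 1) *
          (1 - Matrix.single (0, 0) (0, 0) 1 - Matrix.single (1, 1) (1, 1) 1)) := by
      rw [actX_00_eq]
      ext ⟨i, j⟩ ⟨k, l⟩
      fin_cases i <;> fin_cases j <;> fin_cases k <;> fin_cases l <;>
        simp [Matrix.mul_apply, Fintype.sum_prod_type, Matrix.one_apply]
      field_simp
    rw [e]
    exact Subalgebra.smul_mem _ (mul_mem (sub_mem hX (Subalgebra.smul_mem _ (one_mem _) _))
      (sub_mem (sub_mem (one_mem _) h00) h11)) _
  have h10 : (Matrix.single (1, 0) (1, 0) 1 : Mat₄) ∈ actMat.range := by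
    have e : (Matrix.single (1, 0) (1, 0) 1 : Mat₄) = 1 - Matrix.single (0, 0) (0, 0) 1 -
        Matrix.single (1, 1) (1, 1) 1 - Matrix.single (0, 1) (0, 1) 1 := by
      ext ⟨i, j⟩ ⟨k, l⟩
      fin_cases i <;> fin_cases j <;> fin_cases k <;> fin_cases l <;> simp
    rw [e]
    exact sub_mem (sub_mem (sub_mem (one_mem _) h00) h11) h01
  -- Multiplying Y by a diagonal unit on each side isolates one entry, which can be normalized when
  -- it is nonzero.
  have entry {Y : Mat₄} (hY : Y ∈ actMat.range) {p r : Fin 2 × Fin 2}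
      (hp : (Matrix.single p p 1 : Mat₄) ∈ actMat.range)
      (hr : (Matrix.single r r 1 : Mat₄) ∈ actMat.range) (h : Y p r ≠ 0) :
      (Matrix.single p r 1 : Mat₄) ∈ actMat.range := by
    have e : (Matrix.single p r 1 : Mat₄) =
        (Y p r)⁻¹ • (Matrix.single p p 1 * Y * Matrix.single r r 1) := by
      rw [Matrix.single_mul_mul_single, Matrix.smul_single]
      simp [h]
    rw [e]
    exact Subalgebra.smul_mem _ (mul_mem (mul_mem hp hY) hr) _
  have comp {p r s : Fin 2 × Fin 2} (h : (Matrix.single p r 1 : Mat₄) ∈ actMat.range)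
      (h' : (Matrix.single r s 1 : Mat₄) ∈ actMat.range) :
      (Matrix.single p s 1 : Mat₄) ∈ actMat.range := by
    simpa using mul_mem h h'
  have u1 := entry hE h00 h01 (by simp [Θ_E])
  have u2 := entry hE h00 h10 (by simp [Θ_E, hq])
  have u3 := entry hE h01 h11 (by simp [Θ_E, hq])
  have d1 := entry hF h01 h00 (by simp [Θ_F, hq])
  have d2 := entry hF h10 h00 (by simp [Θ_F])
  have d3 := entry hF h11 h01 (by simp [Θ_F])
  -- The entries of E join every index to `(0, 0)`, those of F lead back; the index `(1, 1)` is
  -- reached in two steps through `(0, 1)`.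
  have toTop : ∀ p, (Matrix.single (0, 0) p 1 : Mat₄) ∈ actMat.range := by
    rintro ⟨i, j⟩
    fin_cases i <;> fin_cases j
    exacts [h00, u1, u2, comp u1 u3]
  have fromTop : ∀ p, (Matrix.single p (0, 0) 1 : Mat₄) ∈ actMat.range := by
    rintro ⟨i, j⟩
    fin_cases i <;> fin_cases j
    exacts [h00, d1, d2, comp d3 d1]
  exact comp (fromTop p) (toTop r)

theorem actMat_surjective : Function.Surjective actMat := by
  intro Y
  change Y ∈ actMat.range
  rw [Matrix.matrix_eq_sum_single Y]
  refine sum_mem fun p _ => sum_mem fun r _ => ?_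
  simpa using Subalgebra.smul_mem _ (single_mem_range_actMat p r) (Y p r)

/-! ### Simplicity and dimension -/

/-- The trace pairing on matrices is nondegenerate, and by surjectivity the matrices `actMat x` are
all the test matrices. -/
theorem traceForm_injective : Function.Injective traceForm := by
  intro Y Z h
  rw [Matrix.ext_iff_trace_mul_right]
  intro W
  obtain ⟨x, rfl⟩ := actMat_surjective W
  exact LinearMap.congr_fun h x

/-- Sub-bimodules of the range pull back to two-sided ideals of `Mat₄`, which is a simple ring. -/
theorem isSimpleSubBimodule_H₁₁ : IsSimpleSubBimodule H₁₁ := by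
  rw [range_matrixCoeff_act]
  refine ⟨?_, ?_, ?_⟩
  · rintro x _ ⟨Y, rfl⟩
    exact ⟨⟨_, (dualLeft_traceForm x Y).symm⟩, ⟨_, (dualRight_traceForm x Y).symm⟩⟩
  · intro h
    rw [LinearMap.range_eq_bot] at h
    have h1 : (1 : Mat₄) = 0 := traceForm_injective (by rw [h]; rfl)
    exact one_ne_zero h1
  · intro U hU hb
    -- Closure under multiplication by an arbitrary matrix uses surjectivity: that matrix is the
    -- action of some element of the double, and U is stable under it.
    let J : TwoSidedIdeal Mat₄ := TwoSidedIdeal.mk' {Y | traceForm Y ∈ U} (by simp)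
      (fun {x y} hx hy => by simpa using add_mem hx hy) (fun {x} hx => by simpa using hx)
      (fun {x y} hy => by
        obtain ⟨z, rfl⟩ := actMat_surjective x
        simpa [dualLeft_traceForm] using (hb z _ hy).1)
      (fun {x y} hx => by
        obtain ⟨z, rfl⟩ := actMat_surjective y
        simpa [dualRight_traceForm] using (hb z _ hx).2)
    have hJ (Y : Mat₄) : Y ∈ J ↔ traceForm Y ∈ U := TwoSidedIdeal.mem_mk' ..
    rcases eq_bot_or_eq_top J with h | h
    · left
      rw [eq_bot_iff]
      intro f hf
      obtain ⟨Y, rfl⟩ := hU hf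
      have : Y ∈ J := (hJ Y).2 hf
      rw [h, TwoSidedIdeal.mem_bot] at this
      simp [this]
    · right
      refine le_antisymm hU ?_
      rintro _ ⟨Y, rfl⟩
      rw [← hJ, h]
      trivial

theorem finrank_H₁₁ : Module.finrank Kq H₁₁ = 16 := by
  rw [range_matrixCoeff_act, LinearMap.finrank_range_of_inj traceForm_injective]
  simp [Module.finrank_matrix]

/-! ### The adapted basis of rank-one matrices -/

/-- The columns are vectors of `V₁⁺ ⊗ V₁⁻`, the first two of them annihilated by `E`. -/
def colBasis : Matrix (Fin 2 × Fin 2) (Fin 4) Kq := Matrix.of fun p =>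
  !![![0, 1, 0, 0], ![q, 0, 0, 1]; ![-1, 0, 0, 0], ![0, 0, 1, 0]] p.1 p.2

/-- The rows are covectors of `V₁⁺ ⊗ V₁⁻`, the first and the last annihilated by `E`. -/
def rowBasis : Matrix (Fin 4) (Fin 2 × Fin 2) Kq := Matrix.of fun i p =>
  !![![0, 0, 1, 0], ![0, 0, 0, q]; ![0, 1, 0, -1], ![1, 0, 0, 0]] p.1 p.2 i

theorem exists_colBasis_mul : ∃ U : Matrix (Fin 4) (Fin 2 × Fin 2) Kq, colBasis * U = 1 := by
  refine ⟨Matrix.of fun i p =>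
    !![![0, 1, 0, 0], ![0, 0, 0, 1]; ![-1, 0, 0, q], ![0, 0, 1, 0]] p.1 p.2 i, ?_⟩
  ext ⟨i, j⟩ ⟨k, l⟩
  fin_cases i <;> fin_cases j <;> fin_cases k <;> fin_cases l <;>
    simp [colBasis, Matrix.mul_apply, Fin.sum_univ_four]

theorem exists_mul_rowBasis : ∃ W : Matrix (Fin 2 × Fin 2) (Fin 4) Kq, W * rowBasis = 1 := by
  have hq := q_ne_zero
  refine ⟨Matrix.of fun p =>
    !![![0, 0, 1, 0], ![0, q⁻¹, 0, q⁻¹]; ![0, 1, 0, 0], ![1, 0, 0, 0]] p.1 p.2, ?_⟩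
  ext ⟨i, j⟩ ⟨k, l⟩
  fin_cases i <;> fin_cases j <;> fin_cases k <;> fin_cases l <;>
    simp [rowBasis, Matrix.mul_apply, Fin.sum_univ_four, hq]

/-- The factors which normalize the products of a column of `colBasis` and a row of `rowBasis`. -/
def scaling : Matrix (Fin 4) (Fin 4) Kq :=
  !![q / (q - q⁻¹), -1, -q / (q - q⁻¹), q⁻¹ / (q - q⁻¹) ^ 2;
     -1, q⁻¹ * (q - q⁻¹), 1, -(q ^ 2)⁻¹ / (q - q⁻¹);
     q, -(q - q⁻¹), -q, q⁻¹ / (q - q⁻¹);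
     -q, q - q⁻¹, q, -q⁻¹ / (q - q⁻¹)]

theorem scaling_ne_zero (i j : Fin 4) : scaling i j ≠ 0 := by
  have hq := q_ne_zero
  have hs := q_sub_ne_zero
  have hs' : q⁻¹ - q ≠ 0 := fun h => hs (by linear_combination -h)
  fin_cases i <;> fin_cases j <;> simp [scaling, hq, hs, hs']

/-- The basis of the endomorphisms of `V₁⁺ ⊗ V₁⁻` which corresponds to `basisH₁₁`. -/
def matBasis (i j : Fin 4) : Mat₄ :=
  scaling i j • Matrix.vecMulVec (colBasis.col i) (rowBasis.row j)

theorem mul_mul_eq_sum_vecMulVec {R l m n o : Type*} [CommSemiring R] [Fintype m] [Fintype n]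
    (A : Matrix l m R) (Z : Matrix m n R) (B : Matrix n o R) :
    A * Z * B = ∑ i, ∑ j, Z i j • Matrix.vecMulVec (A.col i) (B.row j) := by
  ext p r
  simp only [Matrix.mul_apply, Matrix.sum_apply, Matrix.smul_apply, Matrix.vecMulVec_apply,
    Finset.sum_mul, smul_eq_mul, Matrix.col_apply, Matrix.row_apply]
  rw [Finset.sum_comm]
  refine Finset.sum_congr rfl fun i _ => Finset.sum_congr rfl fun j _ => ?_
  ring

/-- With C and R the matrices of columns and of rows, every Y equals C (U Y W) R. Expanding this
product writes Y as a combination of the products of a column of C and a row of R, and the nonzero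
scalings can be absorbed into the coefficients. -/
theorem span_matBasis :
    Submodule.span Kq (Set.range fun p : Fin 4 × Fin 4 => matBasis p.1 p.2) = ⊤ := by
  rw [eq_top_iff]
  rintro Y -
  obtain ⟨U, hU⟩ := exists_colBasis_mul
  obtain ⟨W, hW⟩ := exists_mul_rowBasis
  have e : Y = ∑ i, ∑ j, ((U * Y * W) i j * (scaling i j)⁻¹) • matBasis i j := by
    have e1 : Y = colBasis * (U * Y * W) * rowBasis := by
      calc Y = (colBasis * U) * Y * (W * rowBasis) := by rw [hU, hW, one_mul, mul_one]
        _ = _ := by simp only [Matrix.mul_assoc]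
    refine e1.trans ((mul_mul_eq_sum_vecMulVec _ _ _).trans ?_)
    simp only [matBasis, smul_smul, inv_mul_cancel_right₀ (scaling_ne_zero _ _)]
  rw [e]
  exact sum_mem fun i _ => sum_mem fun j _ => Submodule.smul_mem _ _
    (Submodule.subset_span ⟨(i, j), rfl⟩)

theorem linearIndependent_matBasis :
    LinearIndependent Kq fun p : Fin 4 × Fin 4 => matBasis p.1 p.2 :=
  linearIndependent_of_top_le_span_of_card_eq_finrank span_matBasis.ge
    (by simp [Module.finrank_matrix])

set_option maxHeartbeats 4000000 in
-- This is the computation tying the listed elements to the module. Column 0 is the invariant vector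
-- q e₀₁ − e₁₀; contracting `X t.1 r.1 * X t.2 r.2` with it over r gives scalars, by the commutation
-- and determinant relations. Hence the first four elements lie in H ⊗ 1. The `scaling` factors are
-- the ones that make all sixteen identities exact.
theorem basisH₁₁_eq (i j : Fin 4) :
    basisH₁₁ i j = ∑ r, ∑ p, matBasis i j r p • coeffTensor p r := by
  have hq := q_ne_zero
  have hs : q ^ 2 - 1 ≠ 0 := sub_ne_zero.2 (q_pow_ne_one two_ne_zero)
  fin_cases i <;> fin_cases j <;>
    -- Both sides are brought to ordered monomials: F before E in H, the products in C reordered,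
    -- with ad and da eliminated through the determinant relations. Only identities between scalars
    -- in q remain.
    simp [basisH₁₁, matBasis, scaling, colBasis, rowBasis, coeffTensor, Lop, X, v₁, v₂, v₃, v₄,
      casimir, Fintype.sum_prod_type, Matrix.vecMulVec_apply, Uq.E_mul_F, Cq.b_a, Cq.c_a, Cq.d_b,
      Cq.d_c, Cq.c_b, Cq.a_d, Cq.d_a, pow_two (_ : Cq), TensorProduct.add_tmul,
      TensorProduct.tmul_add, TensorProduct.neg_tmul, TensorProduct.sub_tmul,
      ← TensorProduct.smul_tmul', smul_smul, smul_sub] <;>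
    match_scalars <;> field_simp <;> ring

theorem ι_basisH₁₁ (i j : Fin 4) : ι pairing (basisH₁₁ i j) = traceForm (matBasis i j) := by
  simp only [basisH₁₁_eq, traceForm_eq_sum, map_sum, map_smul]

theorem H₁₁_eq_span : H₁₁ = Submodule.span Kq
    (Set.range fun p : Fin 4 × Fin 4 => ι pairing (basisH₁₁ p.1 p.2)) := by
  simp only [ι_basisH₁₁]
  rw [range_matrixCoeff_act, LinearMap.range_eq_map, ← span_matBasis, Submodule.map_span,
    ← Set.range_comp]
  rfl

/-! ### Highest-weight bivectors -/

/-- The two actions of E become left and right multiplication by `Θ Uq.E`, and injectivity of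
`traceForm` removes the trace form from the equations. -/
theorem mem_hwBivectors_iff {f : Module.Dual Kq (Double pairing)} : f ∈ hwBivectors H₁₁ ↔
    ∃ Y, traceForm Y = f ∧ Θ Uq.E * Y = 0 ∧ Y * Θ Uq.E = 0 := by
  simp only [hwBivectors, Submodule.mem_inf, LinearMap.mem_ker, range_matrixCoeff_act,
    LinearMap.mem_range]
  constructor
  · rintro ⟨⟨⟨Y, rfl⟩, h⟩, h'⟩
    rw [dualLeft_traceForm, actMat_ofH, map_eq_zero_iff _ traceForm_injective] at h
    rw [dualRight_traceForm, actMat_ofH, map_eq_zero_iff _ traceForm_injective] at h'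
    exact ⟨Y, rfl, h, h'⟩
  · rintro ⟨Y, rfl, h, h'⟩
    refine ⟨⟨⟨Y, rfl⟩, ?_⟩, ?_⟩
    · rw [dualLeft_traceForm, actMat_ofH, h, map_zero]
    · rw [dualRight_traceForm, actMat_ofH, h', map_zero]

/-- The positions in `basisH₁₁` of the highest-weight bivectors `v₁`, `v₂`, `v₃`, `v₄`. -/
def hwIndex : Fin 4 → Fin 4 × Fin 4 := ![(1, 0), (1, 3), (0, 0), (0, 3)]

theorem hwIndex_injective : Function.Injective hwIndex := by decide

theorem E_mul_matBasis (i : Fin 4) :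
    Θ Uq.E * matBasis (hwIndex i).1 (hwIndex i).2 = 0 ∧
      matBasis (hwIndex i).1 (hwIndex i).2 * Θ Uq.E = 0 := by
  have hq := q_ne_zero
  -- Columns 0 and 1 are the invariant vector q e₀₁ − e₁₀ and the top vector e₀₀.
  have hcol : Θ Uq.E *ᵥ colBasis.col 0 = 0 ∧ Θ Uq.E *ᵥ colBasis.col 1 = 0 := by
    constructor <;> ext ⟨i, j⟩ <;> fin_cases i <;> fin_cases j <;>
      simp [Θ_E, colBasis, Matrix.mulVec, dotProduct, Fintype.sum_prod_type]
  -- Row 0 is the coordinate covector at `(1, 1)`; row 3 is the invariant covector, with entries q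
  -- at `(0, 1)` and −1 at `(1, 0)`.
  have hrow : rowBasis.row 0 ᵥ* Θ Uq.E = 0 ∧ rowBasis.row 3 ᵥ* Θ Uq.E = 0 := by
    constructor <;> ext ⟨i, j⟩ <;> fin_cases i <;> fin_cases j <;>
      simp [Θ_E, rowBasis, Matrix.vecMul, dotProduct, Fintype.sum_prod_type, hq]
  fin_cases i <;>
    simp [hwIndex, matBasis, Matrix.mul_vecMulVec, Matrix.vecMulVec_mul, hcol, hrow]

/-- The columns of Y lie in the kernel of E and its rows in the space of covectors killed by E, both
of dimension two, so Y is determined by four entries. -/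
theorem eq_sum_matBasis_of_E_mul {Y : Mat₄} (h : Θ Uq.E * Y = 0) (h' : Y * Θ Uq.E = 0) :
    ∃ t : Fin 4 → Kq, Y = ∑ i, t i • matBasis (hwIndex i).1 (hwIndex i).2 := by
  have hq := q_ne_zero
  have hs : q ^ 2 - 1 ≠ 0 := sub_ne_zero.2 (q_pow_ne_one two_ne_zero)
  -- Each coefficient is read off from an entry at which only one of the four matrices is nonzero,
  -- divided by the value of that matrix there.
  refine ⟨![-Y (0, 0) (1, 1), q ^ 2 * (q - q⁻¹) * Y (0, 0) (1, 0),
    -(q - q⁻¹) / q * Y (1, 0) (1, 1), q * (q - q⁻¹) ^ 2 * Y (1, 0) (1, 0)], ?_⟩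
  have r (p : Fin 2 × Fin 2) : Y (0, 1) p = - q * Y (1, 0) p ∧ Y (1, 1) p = 0 := by
    have h1 := congrFun (congrFun h (0, 0)) p
    have h2 := congrFun (congrFun h (1, 0)) p
    simp [Θ_E, Matrix.mul_apply, Fintype.sum_prod_type] at h1 h2
    exact ⟨by linear_combination h1, h2⟩
  have c (p : Fin 2 × Fin 2) : Y p (0, 0) = 0 ∧ Y p (0, 1) = - q * Y p (1, 0) := by
    have h1 := congrFun (congrFun h' p) (0, 1)
    have h2 := congrFun (congrFun h' p) (1, 1)
    simp [Θ_E, Matrix.mul_apply, Fintype.sum_prod_type] at h1 h2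
    refine ⟨h1, ?_⟩
    field_simp at h2
    linear_combination h2
  ext ⟨i, j⟩ ⟨k, l⟩
  fin_cases i <;> fin_cases j <;> fin_cases k <;> fin_cases l <;>
    simp [Fin.sum_univ_four, hwIndex, matBasis, scaling, colBasis, rowBasis,
      Matrix.vecMulVec_apply, r, c] <;>
    field_simp <;> ring

theorem hwBivectors_eq_span_range : hwBivectors H₁₁ = Submodule.span Kq
    (Set.range fun i => traceForm (matBasis (hwIndex i).1 (hwIndex i).2)) := by
  apply le_antisymm
  · intro f hf
    obtain ⟨Y, rfl, h, h'⟩ := mem_hwBivectors_iff.1 hf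
    obtain ⟨t, rfl⟩ := eq_sum_matBasis_of_E_mul h h'
    simp only [map_sum, map_smul]
    exact sum_mem fun i _ => Submodule.smul_mem _ _ (Submodule.subset_span ⟨i, rfl⟩)
  · rw [Submodule.span_le]
    rintro _ ⟨i, rfl⟩
    exact mem_hwBivectors_iff.2 ⟨_, rfl, E_mul_matBasis i⟩

/-- The four generators are the images, under an injective map, of distinct members of a linearly
independent family. -/
theorem finrank_hwBivectors : Module.finrank Kq (hwBivectors H₁₁) = 4 := by
  have h := (linearIndependent_matBasis.comp hwIndex hwIndex_injective).map' traceForm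
    (LinearMap.ker_eq_bot.2 traceForm_injective)
  rw [hwBivectors_eq_span_range]
  exact (finrank_span_eq_card h).trans (Fintype.card_fin 4)

theorem hwBivectors_eq_span : hwBivectors H₁₁ = Submodule.span Kq
    {ι pairing v₁, ι pairing v₂, ι pairing v₃, ι pairing v₄} := by
  have h : (fun i => traceForm (matBasis (hwIndex i).1 (hwIndex i).2)) =
      ![ι pairing v₁, ι pairing v₂, ι pairing v₃, ι pairing v₄] := by
    ext1 i
    rw [← ι_basisH₁₁]
    fin_cases i <;> rfl
  rw [hwBivectors_eq_span_range, h]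
  simp only [Matrix.range_cons, Matrix.range_empty, Set.union_empty, Set.singleton_union]

/-! ### Weights -/

/-- For a product of a column and a row, left multiplication by K acts on the column only and right
multiplication by K⁻¹ on the row only, so the two weights are found separately. -/
theorem hasWeight_matBasis (i j : Fin 4) {m n : ℤ}
    (hm : Θ Uq.K *ᵥ colBasis.col i = q ^ m • colBasis.col i)
    (hn : rowBasis.row j ᵥ* Θ Uq.Ki = q ^ n • rowBasis.row j) :
    HasWeight (ι pairing (basisH₁₁ i j)) m n := by
  rw [HasWeight, ι_basisH₁₁, dualLeft_traceForm, dualRight_traceForm, actMat_ofH, actMat_ofH,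
    ← map_smul, ← map_smul, matBasis]
  constructor <;> congr 1
  · rw [Matrix.mul_smul, Matrix.mul_vecMulVec, hm, Matrix.smul_vecMulVec, smul_comm]
  · rw [Matrix.smul_mul, Matrix.vecMulVec_mul, hn, Matrix.vecMulVec_smul, smul_comm]

theorem K_mulVec_colBasis :
    Θ Uq.K *ᵥ colBasis.col 0 = q ^ (0 : ℤ) • colBasis.col 0 ∧
      Θ Uq.K *ᵥ colBasis.col 1 = q ^ (2 : ℤ) • colBasis.col 1 := by
  rw [Θ_K_eq]
  constructor <;> ext ⟨i, j⟩ <;> fin_cases i <;> fin_cases j <;>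
    simp [colBasis, Matrix.mulVec_diagonal]

theorem rowBasis_vecMul_Ki :
    rowBasis.row 0 ᵥ* Θ Uq.Ki = q ^ (2 : ℤ) • rowBasis.row 0 ∧
      rowBasis.row 3 ᵥ* Θ Uq.Ki = q ^ (0 : ℤ) • rowBasis.row 3 := by
  have hq := q_ne_zero
  constructor <;> ext ⟨i, j⟩ <;> fin_cases i <;> fin_cases j <;>
    simp [Θ_Ki, rowBasis, Matrix.vecMul, dotProduct, Fintype.sum_prod_type, hq]
  rw [← pow_two]

end QDouble

end
theorem mainTheorem10 :
    QDouble.IsSimpleSubBimodule QDouble.H₁₁ ∧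
    Module.finrank QDouble.Kq QDouble.H₁₁ = 16 ∧
    QDouble.H₁₁ = Submodule.span QDouble.Kq (Set.range fun p : Fin 4 × Fin 4 =>
      QDouble.Double.ι QDouble.pairing (QDouble.basisH₁₁ p.1 p.2)) ∧
    Module.finrank QDouble.Kq (QDouble.hwBivectors QDouble.H₁₁) = 4 ∧
    QDouble.hwBivectors QDouble.H₁₁ = Submodule.span QDouble.Kq
      {QDouble.Double.ι QDouble.pairing QDouble.v₁, QDouble.Double.ι QDouble.pairing QDouble.v₂,
        QDouble.Double.ι QDouble.pairing QDouble.v₃, QDouble.Double.ι QDouble.pairing QDouble.v₄} ∧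
    QDouble.HasWeight (QDouble.Double.ι QDouble.pairing QDouble.v₁) 2 2 ∧
    QDouble.HasWeight (QDouble.Double.ι QDouble.pairing QDouble.v₂) 2 0 ∧
    QDouble.HasWeight (QDouble.Double.ι QDouble.pairing QDouble.v₃) 0 2 ∧
    QDouble.HasWeight (QDouble.Double.ι QDouble.pairing QDouble.v₄) 0 0 :=
  ⟨QDouble.isSimpleSubBimodule_H₁₁, QDouble.finrank_H₁₁, QDouble.H₁₁_eq_span,
    QDouble.finrank_hwBivectors, QDouble.hwBivectors_eq_span,
    -- The elements `v₁`, …, `v₄` are, by definition, the entries of `basisH₁₁` at (1,0), (1,3),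
    -- (0,0), (0,3). Column 1 and row 0 have weight 2; the invariant column 0 and row 3 have weight
    -- 0.
    QDouble.hasWeight_matBasis 1 0 QDouble.K_mulVec_colBasis.2 QDouble.rowBasis_vecMul_Ki.1,
    QDouble.hasWeight_matBasis 1 3 QDouble.K_mulVec_colBasis.2 QDouble.rowBasis_vecMul_Ki.2,
    QDouble.hasWeight_matBasis 0 0 QDouble.K_mulVec_colBasis.1 QDouble.rowBasis_vecMul_Ki.1,
    QDouble.hasWeight_matBasis 0 3 QDouble.K_mulVec_colBasis.1 QDouble.rowBasis_vecMul_Ki.2⟩
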